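/- Let $q$ be a prime power, let $\mathbb F_q$ be the finite field with $q$ elements, and let $\alpha\in\overline{\mathbb F}_q$ be algebraic of degree $n$ over $\mathbb F_q$, so that $\mathbb F_{q^n}=\mathbb F_q(\alpha)$. For a positive integer $m\le n$ and $\gamma\in\mathbb F_{q^n}$ put $$\mathcal J_{\gamma,m}=\{\gamma+a_0+a_1\alpha+\cdots+a_{m-1}\alpha^{m-1}: a_0,\dots,a_{m-1}\in\mathbb F_q\},\qquad \mathcal J_{\gamma,m}^*=\mathcal J_{\gamma,m}\setminus\{0\},$$ and, for an integer $k\ge 1$, $$k(\mathcal J_{\gamma,m}^{-1})=\{x_1^{-1}+\cdots+x_k^{-1}: x_1,\dots,x_k\in\mathcal J_{\gamma,m}^*\}.$$ Then for every fixed integer $k\ge1$, if $m<n/(4k^2-2k)$, one has $$\# k(\mathcal J_{\gamma,m}^{-1})\ \ge\ q^{(k+o(1))m}\qquad (m\to\infty),$$ uniformly over $q$, $n$, $\alpha$ and $\gamma$. That is: for every integer $k\ge 1$ and every $\varepsilon>0$ there is an $M$, depending only on $k$ and $\varepsilon$, such that $\# k(\mathcal J_{\gamma,m}^{-1})\ge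 q^{(k-\varepsilon)m}$ for all $q$, $n$, $\alpha$, $\gamma$ as above and all integers $m\ge M$ with $m<n/(4k^2-2k)$. -/

import Mathlib

/-- The initial interval `V_m` in an extension `K` of `F`: the set of all
`a_0 + a_1 α + ⋯ + a_{m-1} α^{m-1}` with coefficients `a_i` in `F`. -/
def initialInterval (F : Type*) {K : Type*} [Field F] [Field K] [Algebra F K]
    (α : K) (m : ℕ) : Set K :=
  {x | ∃ a : Fin m → F, x = ∑ i : Fin m, a i • α ^ (i : ℕ)}

/-- The shifted set `J_{γ,m} = γ + V_m`. -/
def shiftedInterval (F : Type*) {K : Type*} [Field F] [Field K] [Algebra F K]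
    (α γ : K) (m : ℕ) : Set K :=
  {x | ∃ v ∈ initialInterval F α m, x = γ + v}

/-- The interval `J*_{γ,m} = J_{γ,m} \ {0}`. -/
def punctInterval (F : Type*) {K : Type*} [Field F] [Field K] [Algebra F K]
    (α γ : K) (m : ℕ) : Set K :=
  shiftedInterval F α γ m \ {0}

/-- The `k`-fold sumset `k(J⁻¹_{γ,m})`: the set of all `x_1⁻¹ + ⋯ + x_k⁻¹` with
`x_1, …, x_k` in `J*_{γ,m}` (repetitions allowed). -/
def reciprocalSumset (F : Type*) {K : Type*} [Field F] [Field K] [Algebra F K]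
    (α γ : K) (m k : ℕ) : Set K :=
  {y | ∃ x : Fin k → K, (∀ i, x i ∈ punctInterval F α γ m) ∧ y = ∑ i, (x i)⁻¹}

/-! Write elements of the interval as γ + u(α) with deg u ≤ μ = m - 1. It suffices to find a set A
of q^(m-o(m)) such u whose k-subsets have distinct sums of 1/(γ + u(α)): then binom(|A|, k) bounds
the sumset from below.

Two k-subsets with equal sums give, on clearing denominators, a nonzero Q(X, Y) vanishing at (α, γ),
of weighted degree at most (2k-1)μ when X has weight 1 and Y weight μ. By a weighted Bézout bound
the resultant of two such polynomials has degree at most (2k-1)²μ < n, too small to vanish at α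
unless it is zero. So once a collision exists, one irreducible R divides every such Q
(`exists_irreducible_relation`).

For suitable u, Q(-u) is a product of differences w - u of elements of A, and R(-u) divides it.
Hence A has no collision if each R(-u) has a prime factor dividing no w - u with w ≠ u in A
(`injOn_sum_inv_of_private_prime`). Such an A comes from Chebyshev's argument on large prime factors
of polynomial values (`exists_large_private_primes`): most R(-u) have nearly the generic degree,
their smooth parts are smaller on average, so many have a prime factor of degree close to m; a
maximal independent choice of u then makes these primes private. Lagrange interpolation at deg_Y R +
1 points replaces factoring R, so nothing is needed about its roots. -/

namespace ReciprocalSumset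

open Polynomial UniqueFactorizationMonoid

/-! ### Weighted degrees of bivariate polynomials -/

section Weight

variable {F : Type*} [Field F]

/-- The substitution `X ↦ X`, `Y ↦ Y X ^ μ` with the roles of the variables exchanged, so that
its degree is the weighted degree with weights `1` for `X` and `μ` for `Y`. -/
noncomputable def weightHom (F : Type*) [Field F] (μ : ℕ) : F[X][X] →+* F[X][X] :=
  eval₂RingHom (mapRingHom C) (C X * X ^ μ)

lemma coeff_coeff_weightHom (μ : ℕ) (P : F[X][X]) (n i : ℕ) :
    ((weightHom F μ P).coeff n).coeff i
      = if μ * i ≤ n then (P.coeff i).coeff (n - μ * i) else 0 := by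
  induction P using Polynomial.induction_on' with
  | add p q hp hq =>
    rw [map_add, coeff_add, coeff_add, hp, hq, coeff_add, coeff_add]
    split_ifs <;> simp
  | monomial j a =>
    have : weightHom F μ (monomial j a) = a.map C * C (X ^ j) * X ^ (μ * j) := by
      simp [weightHom, mul_pow, pow_mul, mul_assoc]
    rw [this, coeff_mul_X_pow', coeff_monomial]
    have h2 (l : ℕ) : ((a.map C * C (X ^ j)).coeff l).coeff i = if j = i then a.coeff l else 0 := by
      rw [coeff_mul_C, coeff_map, coeff_C_mul_X_pow]
      simp only [eq_comm]
    by_cases hij : j = i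
    · subst hij
      simp only [h2, if_true, apply_ite (fun p : F[X] => p.coeff j), coeff_zero]
    · simp only [h2, if_neg hij, apply_ite (fun p : F[X] => p.coeff i), coeff_zero, ite_self]

lemma natDegree_weightHom_le_iff (μ ω : ℕ) (P : F[X][X]) :
    (weightHom F μ P).natDegree ≤ ω ↔
      ∀ i, P.coeff i ≠ 0 → (P.coeff i).natDegree + μ * i ≤ ω := by
  rw [natDegree_le_iff_coeff_eq_zero]
  constructor
  · intro h i hi
    by_contra! hlt
    have := congrArg (fun p : F[X] => p.coeff i) (h _ hlt)
    simp only [coeff_coeff_weightHom, coeff_zero] at this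
    rw [if_pos (by omega), Nat.add_sub_cancel] at this
    exact hi (leadingCoeff_eq_zero.mp this)
  · intro h n hn
    ext i
    rw [coeff_coeff_weightHom, coeff_zero]
    split_ifs with hle
    · by_cases hi : P.coeff i = 0
      · simp [hi]
      · exact coeff_eq_zero_of_natDegree_lt (by have := h i hi; omega)
    · rfl

lemma weightHom_injective (μ : ℕ) : Function.Injective (weightHom F μ) := by
  rw [injective_iff_map_eq_zero]
  intro P hP
  ext i j
  have := coeff_coeff_weightHom μ P (μ * i + j) i
  rw [hP, if_pos (by omega)] at this
  simpa using this.symm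

lemma natDegree_weightHom_le_of_dvd {μ : ℕ} {P Q : F[X][X]} (h : P ∣ Q) (hQ : Q ≠ 0) :
    (weightHom F μ P).natDegree ≤ (weightHom F μ Q).natDegree:= by
  have hQ' : weightHom F μ Q ≠ 0 := fun h0 =>
    hQ (weightHom_injective μ (h0.trans (map_zero _).symm))
  exact natDegree_le_of_dvd ((weightHom F μ).map_dvd h) hQ'

lemma natDegree_le_of_weight {μ N : ℕ} (hμ : 0 < μ) {P : F[X][X]}
    (h : (weightHom F μ P).natDegree ≤ N * μ) : P.natDegree ≤ N := by
  by_cases hP : P = 0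
  · simp [hP]
  have h1 := (natDegree_weightHom_le_iff _ _ _).mp h P.natDegree
    (by simpa using leadingCoeff_ne_zero.mpr hP)
  refine Nat.le_of_mul_le_mul_left (c := μ) ?_ hμ
  rw [mul_comm μ N]
  omega

lemma natDegree_eval_le_of_weight {μ ω : ℕ} {P : F[X][X]} {u : F[X]}
    (h : (weightHom F μ P).natDegree ≤ ω) (hu : u.natDegree ≤ μ) :
    (P.eval u).natDegree ≤ ω := by
  rw [eval_eq_sum, Polynomial.sum]
  refine natDegree_sum_le_of_forall_le _ _ fun i hi => ?_
  have h1 := (natDegree_weightHom_le_iff _ _ _).mp h i (mem_support_iff.mp hi)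
  have h2 : (u ^ i).natDegree ≤ μ * i := by
    refine natDegree_pow_le.trans ?_
    rw [mul_comm]
    exact Nat.mul_le_mul_right _ hu
  exact natDegree_mul_le.trans (by omega)

/-- Give row i of the Sylvester matrix the weight μ i. A nonzero entry in a column shifted by j has
degree plus row weight at most ω + μ j, with ω the bound for the polynomial in that column. In each
term of the determinant the row weights exceed the column shifts by μ a b in total. The `max`
replaces a truncated subtraction. -/
lemma natDegree_resultant_le {μ ω₁ ω₂ : ℕ} {f g : F[X][X]} (a b : ℕ)
    (hf : (weightHom F μ f).natDegree ≤ ω₁) (hg : (weightHom F μ g).natDegree ≤ ω₂) :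
    (resultant f g a b).natDegree + μ * (a * b) ≤ max (a * ω₂ + b * ω₁) (μ * (a * b)) := by
  rw [natDegree_weightHom_le_iff] at hf hg
  suffices h : (resultant f g a b).natDegree ≤ a * ω₂ + b * ω₁ - μ * (a * b) by omega
  rw [resultant, Matrix.det_apply]
  refine natDegree_sum_le_of_forall_le _ _ fun σ _ => ?_
  rw [Units.smul_def, zsmul_eq_mul]
  refine natDegree_mul_le.trans ?_
  rw [natDegree_intCast, zero_add]
  by_cases hz : ∏ i, sylvester f g a b (σ i) i = 0
  · simp [hz]
  replace hz := Finset.prod_ne_zero_iff.mp hz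
  refine (natDegree_prod_le _ _).trans ?_
  have key : ∑ i, ((sylvester f g a b (σ i) i).natDegree + μ * (σ i : ℕ))
      ≤ ∑ j : Fin a, (ω₂ + μ * (j : ℕ)) + ∑ j : Fin b, (ω₁ + μ * (j : ℕ)) := by
    rw [Fin.sum_univ_add]
    refine add_le_add (Finset.sum_le_sum fun j _ => ?_) (Finset.sum_le_sum fun j _ => ?_)
    · have hi := hz (Fin.castAdd b j) (Finset.mem_univ _)
      revert hi
      generalize σ (Fin.castAdd b j) = l
      simp only [sylvester, Matrix.of_apply, Fin.addCases_left]
      split_ifs with hm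
      · intro h0
        have := hg _ h0
        rw [Set.mem_Icc] at hm
        obtain ⟨c, hc⟩ := Nat.exists_eq_add_of_le hm.1
        rw [hc, Nat.add_sub_cancel_left] at this ⊢
        rw [mul_add]; omega
      · simp
    · have hi := hz (Fin.natAdd a j) (Finset.mem_univ _)
      revert hi
      generalize σ (Fin.natAdd a j) = l
      simp only [sylvester, Matrix.of_apply, Fin.addCases_right]
      split_ifs with hm
      · intro h0
        have := hf _ h0
        rw [Set.mem_Icc] at hm
        obtain ⟨c, hc⟩ := Nat.exists_eq_add_of_le hm.1
        rw [hc, Nat.add_sub_cancel_left] at this ⊢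
        rw [mul_add]; omega
      · simp
  rw [Finset.sum_add_distrib, Equiv.sum_comp σ (fun i : Fin (a + b) => μ * (i : ℕ)),
    Fin.sum_univ_add (fun i : Fin (a + b) => μ * (i : ℕ))] at key
  simp only [Fin.val_castAdd, Fin.val_natAdd, Finset.sum_add_distrib, Finset.sum_const,
    Finset.card_univ, Fintype.card_fin, smul_eq_mul, mul_add] at key
  have : b * (μ * a) = μ * (a * b) := by ring
  omega

end Weight

/-! ### The irreducible relation between α and γ -/

section Relation

variable {F K : Type*} [Field F] [Field K] [Algebra F K]

/-- Evaluation of a bivariate polynomial at `X = α`, `Y = γ`. -/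
noncomputable def evalAt (F : Type*) {K : Type*} [Field F] [Field K] [Algebra F K] (α γ : K) :
    F[X][X] →+* K :=
  eval₂RingHom (aeval α : F[X] →ₐ[F] K).toRingHom γ

@[simp] lemma evalAt_C (α γ : K) (p : F[X]) : evalAt F α γ (C p) = aeval α p := by
  simp [evalAt]

@[simp] lemma evalAt_X (α γ : K) : evalAt F α γ X = γ := by
  simp [evalAt]

lemma exists_irreducible_factor_evalAt_eq_zero {α γ : K} {P : F[X][X]} (hP : P ≠ 0)
    (h : evalAt F α γ P = 0) : ∃ R, Irreducible R ∧ R ∣ P ∧ evalAt F α γ R = 0 := by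
  induction P using WfDvdMonoid.induction_on_irreducible with
  | zero => exact absurd rfl hP
  | unit u hu => exact absurd h (hu.map (evalAt F α γ)).ne_zero
  | mul a i ha hi ih =>
    rw [map_mul, mul_eq_zero] at h
    rcases h with h | h
    · exact ⟨i, hi, dvd_mul_right _ _, h⟩
    · obtain ⟨R, h1, h2, h3⟩ := ih ha h
      exact ⟨R, h1, h2.mul_left _, h3⟩

/-- By Gauss's lemma, if R does not divide Q they are coprime over F(X), so their resultant is
nonzero. Being a combination of R and Q it vanishes at α, although its degree is at most N²μ < n. -/
lemma irreducible_dvd_of_evalAt_eq_zero {α γ : K} {n μ N : ℕ} (hμ : 0 < μ)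
    (hα : ∀ r : F[X], r ≠ 0 → r.natDegree < n → aeval α r ≠ 0) (hn : N * N * μ < n)
    {R Q : F[X][X]} (hR : Irreducible R) (hR0 : R.natDegree ≠ 0)
    (hRw : (weightHom F μ R).natDegree ≤ N * μ) (hRe : evalAt F α γ R = 0)
    (hQw : (weightHom F μ Q).natDegree ≤ N * μ) (hQe : evalAt F α γ Q = 0) : R ∣ Q := by
  by_contra hdvd
  have hprim := hR.isPrimitive hR0
  have hirr := (hprim.irreducible_iff_irreducible_map_fraction_map (K := FractionRing F[X])).mp hR
  rw [hprim.dvd_iff_fraction_map_dvd_fraction_map (FractionRing F[X])] at hdvd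
  have hcop := (hirr.coprime_iff_not_dvd).mpr hdvd
  have hinj : Function.Injective (algebraMap F[X] (FractionRing F[X])) :=
    IsFractionRing.injective _ _
  have hres : resultant R Q ≠ 0 := by
    intro h0
    have h1 : resultant (R.map (algebraMap F[X] (FractionRing F[X])))
        (Q.map (algebraMap F[X] (FractionRing F[X]))) = 0 := by
      rw [natDegree_map_eq_of_injective hinj, natDegree_map_eq_of_injective hinj,
        resultant_map_map, h0, map_zero]
    exact (resultant_eq_zero_iff.mp h1).2 hcop
  obtain ⟨p, q, -, -, hpq⟩ := exists_mul_add_mul_eq_C_resultant R Q le_rfl le_rfl (Or.inl hR0)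
  have hev := congrArg (evalAt F α γ) hpq
  rw [map_add, map_mul, map_mul, hRe, hQe, zero_mul, zero_mul, add_zero, evalAt_C] at hev
  refine hα _ hres ?_ hev.symm
  refine lt_of_le_of_lt ?_ hn
  have h1 := natDegree_resultant_le R.natDegree Q.natDegree hRw hQw
  obtain ⟨c, hc⟩ := Nat.exists_eq_add_of_le (natDegree_le_of_weight hμ hRw)
  obtain ⟨e, he⟩ := Nat.exists_eq_add_of_le (natDegree_le_of_weight hμ hQw)
  generalize R.natDegree = a at *
  generalize Q.natDegree = b at *
  rcases le_max_iff.mp h1 with h1 | h1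
  -- This is (N - a)(N - b)μ ≥ 0.
  · have h2 : a * (N * μ) + b * (N * μ) ≤ N * N * μ + μ * (a * b) := by
      have h3 : N * N * μ + μ * (a * b) = a * (N * μ) + b * (N * μ) + c * e * μ := by
        have : N * N * μ = (a + c) * (b + e) * μ := by rw [← hc, ← he]
        rw [this]
        nth_rewrite 1 [he]
        rw [hc]
        ring
      omega
    omega
  · omega

theorem exists_irreducible_relation {α γ : K} {n μ N : ℕ} (hμ : 0 < μ)
    (hα : ∀ r : F[X], r ≠ 0 → r.natDegree < n → aeval α r ≠ 0) (hn : N * N * μ < n)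
    {P : F[X][X]} (hP : P ≠ 0) (hPw : (weightHom F μ P).natDegree ≤ N * μ)
    (hPe : evalAt F α γ P = 0) :
    ∃ R : F[X][X], Irreducible R ∧ R.natDegree ≠ 0 ∧
      (weightHom F μ R).natDegree ≤ N * μ ∧ evalAt F α γ R = 0 ∧
      ∀ Q : F[X][X], (weightHom F μ Q).natDegree ≤ N * μ → evalAt F α γ Q = 0 → R ∣ Q := by
  obtain ⟨R, hR, hRP, hRe⟩ := exists_irreducible_factor_evalAt_eq_zero hP hPe
  have hRw := (natDegree_weightHom_le_of_dvd (μ := μ) hRP hP).trans hPw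
  -- A factor free of Y would be a nonzero polynomial in X of degree at most Nμ < n vanishing at α.
  have hR0 : R.natDegree ≠ 0 := by
    intro h0
    obtain ⟨r, hr⟩ := natDegree_eq_zero.mp h0
    subst hr
    have hr0 : r ≠ 0 := fun h => hR.ne_zero (by simp [h])
    rw [evalAt_C] at hRe
    refine hα r hr0 ?_ hRe
    have h1 := (natDegree_weightHom_le_iff _ _ _).mp hRw 0 (by simpa using hr0)
    rw [coeff_C_zero] at h1
    have h2 : N * μ ≤ N * N * μ := Nat.mul_le_mul_right _ (Nat.le_mul_self N)
    omega
  exact ⟨R, hR, hR0, hRw, hRe, fun Q hQw hQe =>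
    irreducible_dvd_of_evalAt_eq_zero hμ hα hn hR hR0 hRw hRe hQw hQe⟩

end Relation


/-! ### Collisions between sums of reciprocals -/

section Collision

open Classical in
/-- The numerator, up to cancellation, of `∑ u ∈ S, 1 / (Y + u) - ∑ u ∈ T, 1 / (Y + u)`. -/
noncomputable def collisionPoly {F : Type*} [Field F] (S T : Finset F[X]) : F[X][X] :=
  ∑ u ∈ S, ∏ w ∈ (S ∪ T).erase u, (X + C w) - ∑ u ∈ T, ∏ w ∈ (S ∪ T).erase u, (X + C w)

variable {F K : Type*} [Field F] [Field K] [Algebra F K]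

lemma evalAt_collisionPoly {α γ : K} {S T : Finset F[X]}
    (hS : ∀ u ∈ S, γ + aeval α u ≠ 0) (hT : ∀ u ∈ T, γ + aeval α u ≠ 0)
    (h : ∑ u ∈ S, (γ + aeval α u)⁻¹ = ∑ u ∈ T, (γ + aeval α u)⁻¹) :
    evalAt F α γ (collisionPoly S T) = 0 := by
  classical
  have key (u : F[X]) (hu : u ∈ S ∪ T) (hu0 : γ + aeval α u ≠ 0) :
      ∏ w ∈ (S ∪ T).erase u, (γ + aeval α w)
        = (∏ w ∈ S ∪ T, (γ + aeval α w)) * (γ + aeval α u)⁻¹ := by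
    rw [← Finset.mul_prod_erase _ _ hu, mul_comm (γ + aeval α u), mul_assoc,
      mul_inv_cancel₀ hu0, mul_one]
  simp only [collisionPoly, map_sub, map_sum, map_prod, map_add, evalAt_X, evalAt_C]
  rw [Finset.sum_congr rfl fun u hu => key u (Finset.mem_union_left _ hu) (hS u hu),
    Finset.sum_congr rfl fun u hu => key u (Finset.mem_union_right _ hu) (hT u hu),
    ← Finset.mul_sum, ← Finset.mul_sum, h, sub_self]

lemma weight_X_add_C_le {μ : ℕ} {u : F[X]} (hu : u.natDegree ≤ μ) :
    (weightHom F μ (X + C u)).natDegree ≤ μ := by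
  rw [natDegree_weightHom_le_iff]
  intro i hi
  rw [coeff_add, coeff_X, coeff_C] at *
  rcases i with _ | _ | i
  · simpa using hu
  · simp
  · simp at hi

lemma weight_collisionPoly_le {μ M : ℕ} {S T : Finset F[X]}
    (hS : ∀ u ∈ S, u.natDegree ≤ μ) (hT : ∀ u ∈ T, u.natDegree ≤ μ)
    (hM : S.card + T.card ≤ M + 1) :
    (weightHom F μ (collisionPoly S T)).natDegree ≤ M * μ := by
  classical
  have key (u : F[X]) (hu : u ∈ S ∪ T) :
      (weightHom F μ (∏ w ∈ (S ∪ T).erase u, (X + C w))).natDegree ≤ M * μ := by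
    rw [map_prod]
    refine (natDegree_prod_le _ _).trans ?_
    refine (Finset.sum_le_card_nsmul _ _ μ fun w hw => ?_).trans ?_
    · refine weight_X_add_C_le ?_
      rcases Finset.mem_union.mp (Finset.mem_of_mem_erase hw) with h | h
      · exact hS w h
      · exact hT w h
    · rw [smul_eq_mul, Finset.card_erase_of_mem hu]
      refine Nat.mul_le_mul_right _ ?_
      have := Finset.card_union_le S T
      omega
  rw [collisionPoly, map_sub, map_sum, map_sum]
  refine (natDegree_sub_le _ _).trans (max_le ?_ ?_)
  · exact natDegree_sum_le_of_forall_le _ _ fun u hu => key u (Finset.mem_union_left _ hu)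
  · exact natDegree_sum_le_of_forall_le _ _ fun u hu => key u (Finset.mem_union_right _ hu)

-- Every summand other than that of u contains the factor Y + u, which vanishes at Y = -u.
open Classical in
lemma eval_collisionPoly {S T : Finset F[X]} (hST : Disjoint S T) {u : F[X]} (hu : u ∈ S) :
    (collisionPoly S T).eval (-u) = ∏ w ∈ (S ∪ T).erase u, (w - u) := by
  have hz (v : F[X]) (hv : v ≠ u) : ∏ w ∈ (S ∪ T).erase v, (-u + w) = 0 :=
    Finset.prod_eq_zero (i := u) (Finset.mem_erase.mpr ⟨hv.symm, Finset.mem_union_left _ hu⟩)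
      (by simp)
  simp only [collisionPoly, eval_sub, eval_finsetSum, eval_prod, eval_add, eval_X, eval_C]
  rw [Finset.sum_eq_single_of_mem u hu fun v _ hv => hz v hv, Finset.sum_eq_zero, sub_zero]
  · exact Finset.prod_congr rfl fun w _ => by ring
  · intro v hv
    exact hz v fun h => Finset.disjoint_left.mp hST hu (h ▸ hv)

/-- If two distinct `k`-subsets of `A` have the same sum of reciprocals, then there is a nonzero
polynomial of small weight vanishing at `(α, γ)`, with a controlled value at some `-u`. -/
theorem exists_poly_of_collision {α γ : K} {μ k : ℕ} {A S T : Finset F[X]}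
    (hA : ∀ u ∈ A, u.natDegree ≤ μ) (hA0 : ∀ u ∈ A, γ + aeval α u ≠ 0)
    (hS : S ∈ A.powersetCard k) (hT : T ∈ A.powersetCard k) (hne : S ≠ T)
    (h : ∑ u ∈ S, (γ + aeval α u)⁻¹ = ∑ u ∈ T, (γ + aeval α u)⁻¹) :
    ∃ Q : F[X][X], evalAt F α γ Q = 0 ∧ (weightHom F μ Q).natDegree ≤ (2 * k - 1) * μ ∧
      ∃ u ∈ A, ∃ U : Finset F[X], U ⊆ A ∧ u ∉ U ∧ Q.eval (-u) = ∏ w ∈ U, (w - u) := by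
  classical
  rw [Finset.mem_powersetCard] at hS hT
  -- Common terms cancel, leaving disjoint sets with at most 2k elements in all. Each product omits
  -- one factor, whence 2k - 1.
  have hsub : ∑ u ∈ S \ T, (γ + aeval α u)⁻¹ = ∑ u ∈ T \ S, (γ + aeval α u)⁻¹ := by
    rw [← Finset.sum_inter_add_sum_sdiff S T, ← Finset.sum_inter_add_sum_sdiff T S,
      Finset.inter_comm T S] at h
    exact add_left_cancel h
  have hne' : (S \ T).Nonempty := by
    rw [Finset.sdiff_nonempty]
    exact fun hle => hne (Finset.eq_of_subset_of_card_le hle (by omega))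
  obtain ⟨u, hu⟩ := hne'
  have hSA : S \ T ⊆ A := Finset.sdiff_subset.trans hS.1
  have hTA : T \ S ⊆ A := Finset.sdiff_subset.trans hT.1
  refine ⟨collisionPoly (S \ T) (T \ S),
    evalAt_collisionPoly (fun v hv => hA0 v (hSA hv)) (fun v hv => hA0 v (hTA hv)) hsub,
    weight_collisionPoly_le (fun v hv => hA v (hSA hv)) (fun v hv => hA v (hTA hv)) ?_,
    u, hSA hu, _, ?_, Finset.notMem_erase _ _, eval_collisionPoly disjoint_sdiff_sdiff hu⟩
  · have h1 := Finset.card_le_card (Finset.sdiff_subset (s := S) (t := T))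
    have h2 := Finset.card_le_card (Finset.sdiff_subset (s := T) (t := S))
    omega
  · exact (Finset.erase_subset _ _).trans (Finset.union_subset hSA hTA)

end Collision

/-! ### Private primes exclude collisions -/

section Injectivity

variable {F K : Type*} [Field F] [Field K] [Algebra F K]

lemma poly_of_collision_ne_zero {Q : F[X][X]} {u : F[X]} {U : Finset F[X]}
    (hu : u ∉ U) (h : Q.eval (-u) = ∏ w ∈ U, (w - u)) : Q ≠ 0 := by
  rintro rfl
  rw [eval_zero, eq_comm, Finset.prod_eq_zero_iff] at h
  obtain ⟨w, hw, hw0⟩ := h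
  exact hu (sub_eq_zero.mp hw0 ▸ hw)

/-- A set `A` all of whose elements `u` have a private prime divisor of `R (-u)` has distinct
sums of reciprocals. -/
theorem injOn_sum_inv_of_private_prime {α γ : K} {μ k : ℕ} {A : Finset F[X]} {R : F[X][X]}
    (hA : ∀ u ∈ A, u.natDegree ≤ μ) (hA0 : ∀ u ∈ A, γ + aeval α u ≠ 0)
    (hR : ∀ Q : F[X][X], (weightHom F μ Q).natDegree ≤ (2 * k - 1) * μ →
      evalAt F α γ Q = 0 → R ∣ Q)
    (hp : ∀ u ∈ A, ∃ P : F[X], Irreducible P ∧ P ∣ R.eval (-u) ∧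
      ∀ w ∈ A, w ≠ u → ¬ P ∣ w - u) :
    Set.InjOn (fun S : Finset F[X] => ∑ u ∈ S, (γ + aeval α u)⁻¹)
      (A.powersetCard k : Set (Finset F[X])) := by
  intro S hS T hT h
  by_contra hne
  obtain ⟨Q, hQe, hQw, u, hu, U, hU, huU, hQ⟩ := exists_poly_of_collision hA hA0 hS hT hne h
  obtain ⟨P, hP, hPR, hPA⟩ := hp u hu
  have h1 : P ∣ Q.eval (-u) := hPR.trans (eval_dvd (hR Q hQw hQe))
  rw [hQ, hP.prime.dvd_finsetProd_iff] at h1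
  obtain ⟨w, hw, hw1⟩ := h1
  exact hPA w (hU hw) (fun h => huU (h ▸ hw)) hw1

end Injectivity


/-! ### Polynomials of bounded degree over a finite field -/

section LowDegree

variable (F : Type*) [Field F] [Finite F]

lemma finite_degree_lt (m : ℕ) : {p : F[X] | p.degree < m}.Finite := by
  have : Finite (degreeLT F m) := Finite.of_equiv _ (degreeLTEquiv F m).symm.toEquiv
  have h : {p : F[X] | p.degree < m} = (degreeLT F m : Set F[X]) := by
    ext p; simp [mem_degreeLT]
  rw [h]
  exact Set.toFinite _

/-- The finite set of polynomials of degree less than `m`. -/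
noncomputable def lowDegree (m : ℕ) : Finset F[X] := (finite_degree_lt F m).toFinset

variable {F}

@[simp] lemma mem_lowDegree {m : ℕ} {p : F[X]} : p ∈ lowDegree F m ↔ p.degree < m := by
  simp [lowDegree]

lemma card_lowDegree (m : ℕ) : (lowDegree F m).card = Nat.card F ^ m := by
  have h : {p : F[X] | p.degree < m} = (degreeLT F m : Set F[X]) := by
    ext p; simp [mem_degreeLT]
  rw [lowDegree, ← Set.ncard_eq_toFinset_card _ _, h, ← Nat.card_coe_set_eq]
  rw [SetLike.coe_sort_coe, Nat.card_congr (degreeLTEquiv F m).toEquiv, Nat.card_fun, Nat.card_fin]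

lemma natDegree_lt_of_mem_lowDegree {m : ℕ} {p : F[X]} (hp : p ∈ lowDegree F m) (h0 : p ≠ 0) :
    p.natDegree < m := by
  rwa [mem_lowDegree, degree_eq_natDegree h0, Nat.cast_lt] at hp

lemma sub_mem_lowDegree {m : ℕ} {p q : F[X]} (hp : p ∈ lowDegree F m) (hq : q ∈ lowDegree F m) :
    p - q ∈ lowDegree F m := by
  rw [mem_lowDegree] at *
  exact (degree_sub_le _ _).trans_lt (max_lt hp hq)

open Classical in
lemma card_filter_dvd_sub_le {m : ℕ} {D b : F[X]} (hD : D ≠ 0) (hb : b ∈ lowDegree F m) :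
    ((lowDegree F m).filter fun w => D ∣ w - b).card ≤ Nat.card F ^ (m - D.natDegree) := by
  rw [← card_lowDegree]
  refine Finset.card_le_card_of_injOn (fun w => (w - b) / D) ?_ ?_
  · intro w hw
    rw [Finset.mem_coe, Finset.mem_filter] at hw
    obtain ⟨hw, c, hc⟩ := hw
    have hwb := sub_mem_lowDegree hw hb
    simp only [Finset.mem_coe, hc, mul_div_cancel_left₀ _ hD, mem_lowDegree]
    by_cases hc0 : c = 0
    · simp [hc0]
    · rw [hc] at hwb
      have h1 := natDegree_lt_of_mem_lowDegree hwb (mul_ne_zero hD hc0)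
      rw [natDegree_mul hD hc0] at h1
      rw [degree_eq_natDegree hc0, Nat.cast_lt]
      omega
  · intro w hw w' hw' h
    rw [Finset.mem_coe, Finset.mem_filter] at hw hw'
    obtain ⟨-, c, hc⟩ := hw
    obtain ⟨-, c', hc'⟩ := hw'
    simp only [hc, hc', mul_div_cancel_left₀ _ hD] at h
    have : w - b = w' - b := by rw [hc, hc', h]
    exact sub_left_injective this

end LowDegree

/-! ### Counting monic irreducibles -/

section Primes

variable (F : Type*) [Field F] [Finite F]

open Classical in
/-- The monic irreducible polynomials of degree `n`. -/
noncomputable def primesOfDegree (n : ℕ) : Finset F[X] :=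
  (lowDegree F (n + 1)).filter fun P => Irreducible P ∧ P.Monic ∧ P.natDegree = n

variable {F}

lemma mem_primesOfDegree {n : ℕ} {P : F[X]} :
    P ∈ primesOfDegree F n ↔ Irreducible P ∧ P.Monic ∧ P.natDegree = n := by
  classical
  rw [primesOfDegree, Finset.mem_filter, mem_lowDegree]
  refine ⟨fun h => h.2, fun h => ⟨?_, h⟩⟩
  rw [degree_eq_natDegree h.1.ne_zero, h.2.2, Nat.cast_lt]
  omega

/-- These irreducibles are pairwise coprime and each divides X^(q^n) - X; compare degrees. -/
lemma mul_card_primesOfDegree_le {n : ℕ} (hn : n ≠ 0) :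
    n * (primesOfDegree F n).card ≤ Nat.card F ^ n := by
  have hq : 1 < Nat.card F := Finite.one_lt_card
  have hdvd : ∏ P ∈ primesOfDegree F n, P ∣ (X ^ Nat.card F ^ n - X : F[X]) := by
    refine Finset.prod_dvd_of_coprime ?_ ?_
    · intro P hP Q hQ hPQ
      rw [Finset.mem_coe, mem_primesOfDegree] at hP hQ
      refine (hP.1.coprime_iff_not_dvd).mpr fun h => hPQ ?_
      exact eq_of_monic_of_associated hP.2.1 hQ.2.1 (hP.1.associated_of_dvd hQ.1 h)
    · intro P hP
      rw [mem_primesOfDegree] at hP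
      rw [← hP.1.natDegree_dvd_iff_dvd_X_pow_card_pow_sub_X, hP.2.2]
  have h1 := natDegree_le_of_dvd hdvd (FiniteField.X_pow_card_pow_sub_X_ne_zero _ hn hq)
  rw [FiniteField.X_pow_card_pow_sub_X_natDegree_eq _ hn hq, natDegree_prod _ _ fun P hP =>
    (mem_primesOfDegree.mp hP).1.ne_zero, Finset.sum_congr rfl fun P hP =>
    (mem_primesOfDegree.mp hP).2.2, Finset.sum_const, smul_eq_mul, mul_comm] at h1
  exact h1

end Primes

/-! ### Valuations at irreducible polynomials -/

section Valuation

open scoped Classical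

variable {F : Type*} [Field F]

/-- The exponent of `P` in the factorization of `f`. -/
noncomputable def ordAt (P f : F[X]) : ℕ := (normalizedFactors f).count P

lemma ordAt_mul {P f g : F[X]} (hf : f ≠ 0) (hg : g ≠ 0) :
    ordAt P (f * g) = ordAt P f + ordAt P g := by
  rw [ordAt, normalizedFactors_mul hf hg, Multiset.count_add, ordAt, ordAt]

lemma ordAt_prod {ι : Type*} (s : Finset ι) (f : ι → F[X]) (P : F[X])
    (h : ∀ i ∈ s, f i ≠ 0) : ordAt P (∏ i ∈ s, f i) = ∑ i ∈ s, ordAt P (f i) := by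
  induction s using Finset.induction_on with
  | empty => simp [ordAt]
  | insert a s ha ih =>
    rw [Finset.prod_insert ha, Finset.sum_insert ha, ordAt_mul (h a (by simp)), ih]
    · exact fun i hi => h i (by simp [hi])
    · exact Finset.prod_ne_zero_iff.mpr fun i hi => h i (by simp [hi])

lemma le_ordAt_iff {P f : F[X]} (hP : Irreducible P) (hm : P.Monic) (hf : f ≠ 0) (e : ℕ) :
    e ≤ ordAt P f ↔ P ^ e ∣ f := by
  rw [pow_dvd_iff_le_emultiplicity, emultiplicity_eq_count_normalizedFactors hP hf,
    hm.normalize_eq_self, Nat.cast_le, ordAt]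

lemma natDegree_eq_sum_normalizedFactors {f : F[X]} (hf : f ≠ 0) :
    f.natDegree = ((normalizedFactors f).map natDegree).sum := by
  rw [← natDegree_multiset_prod _ (zero_notMem_normalizedFactors f)]
  exact natDegree_eq_of_degree_eq (degree_eq_degree_of_associated (prod_normalizedFactors hf).symm)

lemma sum_natDegree_mul_ordAt_le {f : F[X]} (hf : f ≠ 0) (s : Finset F[X]) :
    ∑ P ∈ s, P.natDegree * ordAt P f ≤ f.natDegree := by
  rw [natDegree_eq_sum_normalizedFactors hf, Finset.sum_multiset_map_count]
  rw [← Finset.sum_subset (Finset.inter_subset_left (s₁ := s)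
    (s₂ := (normalizedFactors f).toFinset))]
  · refine (Finset.sum_le_sum_of_subset (Finset.inter_subset_right (s₁ := s))).trans_eq' ?_
    exact Finset.sum_congr rfl fun P _ => by rw [smul_eq_mul, mul_comm, ordAt]
  · intro P hP hP'
    have : P ∉ normalizedFactors f := fun h =>
      hP' (Finset.mem_inter.mpr ⟨hP, Multiset.mem_toFinset.mpr h⟩)
    simp [ordAt, Multiset.count_eq_zero_of_notMem this]

lemma sum_natDegree_mul_ordAt_eq {f : F[X]} (hf : f ≠ 0) {s : Finset F[X]}
    (hs : ∀ P, Irreducible P → P.Monic → P ∣ f → P ∈ s) :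
    ∑ P ∈ s, P.natDegree * ordAt P f = f.natDegree := by
  refine le_antisymm (sum_natDegree_mul_ordAt_le hf s) ?_
  rw [natDegree_eq_sum_normalizedFactors hf, Finset.sum_multiset_map_count]
  have hsub : (normalizedFactors f).toFinset ⊆ s := by
    intro P hP
    rw [Multiset.mem_toFinset] at hP
    refine hs P (irreducible_of_normalized_factor _ hP) ?_ (dvd_of_mem_normalizedFactors hP)
    have h1 := normalize_normalized_factor _ hP
    rw [← h1]
    exact monic_normalize (irreducible_of_normalized_factor _ hP).ne_zero
  refine (Finset.sum_le_sum_of_subset hsub).trans_eq' ?_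
  exact Finset.sum_congr rfl fun P _ => by rw [smul_eq_mul, mul_comm, ordAt]

end Valuation


/-! ### Lagrange interpolation and valuations of values -/

section Lagrange

open scoped Classical

/-- Lagrange's formula for the leading coefficient with denominators cleared, so that both the
degree and the P-adic valuation can be applied to it. -/
lemma leadingCoeff_mul_prod_eq_sum {A : Type*} [CommRing A] [IsDomain A] [DecidableEq A]
    {R : A[X]}
    (hR : R ≠ 0) {s : Finset A} (hs : s.card = R.natDegree + 1) :
    R.leadingCoeff * ∏ i ∈ s, ∏ j ∈ s.erase i, (i - j)
      = ∑ i ∈ s, R.eval i * ∏ l ∈ s.erase i, ∏ j ∈ s.erase l, (l - j) := by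
  have hinj : Function.Injective (algebraMap A (FractionRing A)) := IsFractionRing.injective _ _
  have h := Lagrange.leadingCoeff_eq_sum (s := s) (v := algebraMap A (FractionRing A))
    (P := R.map (algebraMap A (FractionRing A))) hinj.injOn (by
      rw [degree_map_eq_of_injective hinj, degree_eq_natDegree hR, hs]; norm_cast)
  rw [leadingCoeff_map_of_injective hinj] at h
  apply hinj
  simp only [map_mul, map_sum, map_prod, map_sub]
  rw [h, Finset.sum_mul]
  refine Finset.sum_congr rfl fun i hi => ?_
  have h0 : ∏ j ∈ s.erase i, (algebraMap A (FractionRing A) i - algebraMap A (FractionRing A) j)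
      ≠ 0 := by
    refine Finset.prod_ne_zero_iff.mpr fun j hj h0 => ?_
    exact Finset.ne_of_mem_erase hj (hinj (sub_eq_zero.mp h0)).symm
  rw [← Finset.mul_prod_erase s _ hi, eval_map_algebraMap, aeval_algebraMap_apply,
    ← mul_assoc, div_mul_cancel₀ _ h0]
  simp

variable {F : Type*} [Field F]

lemma exists_natDegree_eval_ge {R : F[X][X]} (hR : R ≠ 0) {s : Finset F[X]}
    (hs : s.card = R.natDegree + 1) :
    ∃ i ∈ s, R.leadingCoeff.natDegree + ∑ j ∈ s.erase i, (i - j).natDegree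
      ≤ (R.eval i).natDegree := by
  by_contra! hlt
  have hD (i : F[X]) : ∀ j ∈ s.erase i, i - j ≠ 0 := fun j hj h0 =>
    Finset.ne_of_mem_erase hj (sub_eq_zero.mp h0).symm
  have hDD (t : Finset F[X]) : ∀ i ∈ t, ∏ j ∈ s.erase i, (i - j) ≠ 0 := fun i _ =>
    Finset.prod_ne_zero_iff.mpr (hD i)
  have hne : s.Nonempty := Finset.card_pos.mp (by omega)
  have hdeg (t : Finset F[X]) : (∏ i ∈ t, ∏ j ∈ s.erase i, (i - j)).natDegree
      = ∑ i ∈ t, ∑ j ∈ s.erase i, (i - j).natDegree := by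
    rw [natDegree_prod _ _ (hDD t)]
    exact Finset.sum_congr rfl fun i _ => natDegree_prod _ _ (hD i)
  have h := congrArg natDegree (leadingCoeff_mul_prod_eq_sum hR hs)
  rw [natDegree_mul (leadingCoeff_ne_zero.mpr hR) (Finset.prod_ne_zero_iff.mpr (hDD s)),
    hdeg] at h
  -- The `- 1` records strictness; `hlt` makes the preceding sum positive, so truncation loses
  -- nothing.
  have h2 : (∑ i ∈ s, R.eval i * ∏ l ∈ s.erase i, ∏ j ∈ s.erase l, (l - j)).natDegree
      ≤ R.leadingCoeff.natDegree + ∑ i ∈ s, ∑ j ∈ s.erase i, (i - j).natDegree - 1 := by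
    refine natDegree_sum_le_of_forall_le _ _ fun i hi => ?_
    refine natDegree_mul_le.trans ?_
    rw [hdeg, ← Finset.add_sum_erase s _ hi]
    have := hlt i hi
    omega
  obtain ⟨i, hi⟩ := hne
  have := hlt i hi
  have := Finset.add_sum_erase s (fun i => ∑ j ∈ s.erase i, (i - j).natDegree) hi
  omega

lemma exists_ordAt_eval_le {R : F[X][X]} (hR : R ≠ 0) {s : Finset F[X]}
    (hs : s.card = R.natDegree + 1) (hs0 : ∀ i ∈ s, R.eval i ≠ 0) {P : F[X]}
    (hP : Irreducible P) (hm : P.Monic) :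
    ∃ i ∈ s, ordAt P (R.eval i)
      ≤ ordAt P R.leadingCoeff + ∑ j ∈ s.erase i, ordAt P (i - j) := by
  by_contra! hlt
  have hD (i : F[X]) : ∀ j ∈ s.erase i, i - j ≠ 0 := fun j hj h0 =>
    Finset.ne_of_mem_erase hj (sub_eq_zero.mp h0).symm
  have hDD (t : Finset F[X]) : ∀ i ∈ t, ∏ j ∈ s.erase i, (i - j) ≠ 0 := fun i _ =>
    Finset.prod_ne_zero_iff.mpr (hD i)
  have hord (t : Finset F[X]) : ordAt P (∏ i ∈ t, ∏ j ∈ s.erase i, (i - j))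
      = ∑ i ∈ t, ∑ j ∈ s.erase i, ordAt P (i - j) := by
    rw [ordAt_prod _ _ _ (hDD t)]
    exact Finset.sum_congr rfl fun i _ => ordAt_prod _ _ _ (hD i)
  have hlc := leadingCoeff_ne_zero.mpr hR
  have hprod := Finset.prod_ne_zero_iff.mpr (hDD s)
  have h2 : P ^ (ordAt P (R.leadingCoeff * ∏ i ∈ s, ∏ j ∈ s.erase i, (i - j)) + 1) ∣
      R.leadingCoeff * ∏ i ∈ s, ∏ j ∈ s.erase i, (i - j) := by
    nth_rewrite 2 [leadingCoeff_mul_prod_eq_sum hR hs]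
    refine Finset.dvd_sum fun i hi => ?_
    have hprod' := Finset.prod_ne_zero_iff.mpr (hDD (s.erase i))
    rw [← le_ordAt_iff hP hm (mul_ne_zero (hs0 i hi) hprod'), ordAt_mul (hs0 i hi) hprod',
      ordAt_mul hlc hprod, hord, hord, ← Finset.add_sum_erase s _ hi]
    have := hlt i hi
    omega
  rw [← le_ordAt_iff hP hm (mul_ne_zero hlc hprod)] at h2
  omega

lemma ordAt_neg (P f : F[X]) : ordAt P (-f) = ordAt P f := by
  rw [ordAt, ordAt, (Associated.neg_left (Associated.refl f)).normalizedFactors_eq]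

lemma ordAt_sub_comm (P f g : F[X]) : ordAt P (f - g) = ordAt P (g - f) := by
  rw [← neg_sub, ordAt_neg]

lemma ordAt_zero (P : F[X]) : ordAt P 0 = 0 := by
  simp [ordAt]

/-- A `P`-adic analogue of factoring `R`: outside an exceptional set `B` of at most `deg R` points,
the valuation of `R` is bounded by the distances to the points of `B`. -/
lemma exists_ordAt_base {R : F[X][X]} (hR : R ≠ 0) {V : Finset F[X]}
    (hV : ∀ u ∈ V, R.eval u ≠ 0) {P : F[X]} (hP : Irreducible P) (hm : P.Monic) :
    ∃ B ⊆ V, B.card ≤ R.natDegree ∧ ∀ u ∈ V, u ∉ B →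
      ordAt P (R.eval u) ≤ ordAt P R.leadingCoeff + ∑ b ∈ B, ordAt P (u - b) := by
  by_cases hc : V.card < R.natDegree
  · exact ⟨V, Finset.Subset.refl _, hc.le, fun u hu hu' => absurd hu hu'⟩
  -- Twice the quantity ∑ ord R(b) minus the sum of ord(x - y) over unordered pairs; the diagonal
  -- contributes 0 because `ordAt P 0 = 0`.
  let Φ : Finset F[X] → ℤ := fun B =>
    2 * ∑ b ∈ B, (ordAt P (R.eval b) : ℤ) - ∑ x ∈ B, ∑ y ∈ B, (ordAt P (x - y) : ℤ)
  have hΦ (C : Finset F[X]) (x : F[X]) (hx : x ∉ C) : Φ (insert x C)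
      = Φ C + 2 * (ordAt P (R.eval x) - ∑ c ∈ C, (ordAt P (x - c) : ℤ)) := by
    have hsymm : ∑ c ∈ C, (ordAt P (c - x) : ℤ) = ∑ c ∈ C, (ordAt P (x - c) : ℤ) :=
      Finset.sum_congr rfl fun c _ => by rw [ordAt_sub_comm]
    simp only [Φ, Finset.sum_insert hx, Finset.sum_add_distrib, sub_self, ordAt_zero, hsymm]
    push_cast
    ring
  obtain ⟨B, hB, hmax⟩ := Finset.exists_max_image (V.powersetCard R.natDegree) Φ
    (Finset.powersetCard_nonempty.mpr (by omega))
  rw [Finset.mem_powersetCard] at hB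
  refine ⟨B, hB.1, hB.2.le, fun u hu huB => ?_⟩
  obtain ⟨i, hi, hle⟩ := exists_ordAt_eval_le hR (s := insert u B)
    (by rw [Finset.card_insert_of_notMem huB, hB.2])
    (fun i hi => hV i (Finset.insert_subset hu hB.1 hi)) hP hm
  rcases Finset.mem_insert.mp hi with rfl | hiB
  · rwa [Finset.erase_insert huB] at hle
  have hui : u ≠ i := fun h => huB (h ▸ hiB)
  have huC : u ∉ B.erase i := fun h => huB (Finset.mem_of_mem_erase h)
  -- Interpolation on B ∪ {u} has singled out some i in B. Exchanging i for u cannot increase Φ,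
  -- which transfers the bound at i to u.
  have h1 := hmax (insert u (B.erase i)) (by
    rw [Finset.mem_powersetCard]
    refine ⟨Finset.insert_subset hu ((Finset.erase_subset _ _).trans hB.1), ?_⟩
    rw [Finset.card_insert_of_notMem huC, Finset.card_erase_of_mem hiB, hB.2]
    have := Finset.card_pos.mpr ⟨i, hiB⟩
    omega)
  nth_rewrite 2 [← Finset.insert_erase hiB] at h1
  rw [hΦ _ _ huC, hΦ _ _ (Finset.notMem_erase _ _)] at h1
  rw [Finset.erase_insert_of_ne hui, Finset.sum_insert huC, ordAt_sub_comm P i u] at hle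
  rw [← Finset.add_sum_erase B _ hiB]
  zify at hle ⊢
  linarith

end Lagrange

/-! ### Values of low degree and Legendre's formula -/

section Counting

lemma exists_maximal_pairwise {ι : Type*} (L : Finset ι) (r : ι → ι → Prop)
    (hr : ∀ x y, r x y → r y x) :
    ∃ s ⊆ L, (s : Set ι).Pairwise r ∧ ∀ x ∈ L, x ∉ s → ∃ y ∈ s, ¬ r x y := by
  classical
  obtain ⟨s, hs, hmax⟩ := Finset.exists_max_image
    (L.powerset.filter fun s : Finset ι => (s : Set ι).Pairwise r) Finset.card
    ⟨∅, by simp⟩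
  rw [Finset.mem_filter, Finset.mem_powerset] at hs
  refine ⟨s, hs.1, hs.2, fun x hx hxs => ?_⟩
  by_contra! hall
  have h1 := hmax (insert x s) (by
    rw [Finset.mem_filter, Finset.mem_powerset]
    refine ⟨Finset.insert_subset hx hs.1, fun a ha b hb hab => ?_⟩
    rcases Finset.mem_insert.mp ha with ha' | ha' <;>
      rcases Finset.mem_insert.mp hb with hb' | hb'
    · exact absurd (ha'.trans hb'.symm) hab
    · exact ha' ▸ hall b hb'
    · exact hb' ▸ hr _ _ (hall a ha')
    · exact hs.2 ha' hb' hab)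
  rw [Finset.card_insert_of_notMem hxs] at h1
  omega

variable {F : Type*} [Field F] [Finite F]

open scoped Classical

/-- Among deg R + 1 points whose differences have degree at least t, interpolation yields a value
that is not low. So a maximal separated set of low points has at most deg R elements, and every low
point is within degree < t of one of them. -/
lemma card_low_eval_le {R : F[X][X]} (hR : R ≠ 0) (V : Finset F[X]) (t : ℕ) :
    (V.filter fun u => (R.eval u).natDegree < R.leadingCoeff.natDegree + R.natDegree * t).card
      ≤ R.natDegree * Nat.card F ^ t := by
  obtain ⟨s, hs, hpair, hmax⟩ := exists_maximal_pairwise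
    (V.filter fun u => (R.eval u).natDegree < R.leadingCoeff.natDegree + R.natDegree * t)
    (fun x y => t ≤ (x - y).natDegree) (fun x y h => by rwa [natDegree_sub])
  have hcard : s.card ≤ R.natDegree := by
    by_contra! hlt
    obtain ⟨s', hs', hc⟩ := Finset.exists_subset_card_eq (n := R.natDegree + 1) hlt
    obtain ⟨i, hi, hle⟩ := exists_natDegree_eval_ge hR hc
    have h1 := (Finset.mem_filter.mp (hs (hs' hi))).2
    have h2 : (s'.erase i).card • t ≤ ∑ j ∈ s'.erase i, (i - j).natDegree :=
      Finset.card_nsmul_le_sum _ _ _ fun j hj => hpair (hs' hi)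
        (hs' (Finset.mem_of_mem_erase hj)) (Finset.ne_of_mem_erase hj).symm
    rw [Finset.card_erase_of_mem hi, hc, smul_eq_mul, Nat.add_sub_cancel] at h2
    omega
  have hsub : (V.filter fun u =>
      (R.eval u).natDegree < R.leadingCoeff.natDegree + R.natDegree * t)
      ⊆ s.biUnion fun w => (lowDegree F t).image fun c => c + w := by
    intro u hu
    have key : ∃ w ∈ s, u - w ∈ lowDegree F t := by
      by_cases hus : u ∈ s
      · exact ⟨u, hus, by simp [bot_lt_iff_ne_bot]⟩
      · obtain ⟨w, hw, hlt⟩ := hmax u hu hus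
        refine ⟨w, hw, ?_⟩
        rw [mem_lowDegree]
        exact degree_le_natDegree.trans_lt (by exact_mod_cast not_le.mp hlt)
    obtain ⟨w, hw, h⟩ := key
    exact Finset.mem_biUnion.mpr ⟨w, hw, Finset.mem_image.mpr ⟨_, h, sub_add_cancel _ _⟩⟩
  refine (Finset.card_le_card hsub).trans ?_
  refine (Finset.card_biUnion_le_card_mul _ _ (Nat.card F ^ t) fun w _ => ?_).trans
    (Nat.mul_le_mul_right _ hcard)
  exact Finset.card_image_le.trans (card_lowDegree t).le

/-- Legendre's formula: the valuation of w counts the j ≥ 1 with P^j ∣ w, and at most q^(m - j deg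
P) nonzero w qualify, none once j deg P ≥ m. The geometric series is summed by telescoping. -/
lemma sum_ordAt_lowDegree_le {P : F[X]} (hP : Irreducible P) (hm : P.Monic) (m : ℕ) :
    (∑ w ∈ (lowDegree F m).erase 0, ordAt P w) * (Nat.card F ^ P.natDegree - 1)
      ≤ Nat.card F ^ m := by
  set n := P.natDegree with hn
  set q := Nat.card F with hq
  have hq1 : 1 < q := Finite.one_lt_card
  have hn0 : 0 < n := hP.natDegree_pos
  have hord (w : F[X]) (hw : w ∈ (lowDegree F m).erase 0) : ordAt P w
      = ∑ j ∈ Finset.range m, if P ^ (j + 1) ∣ w then 1 else 0 := by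
    rw [Finset.mem_erase] at hw
    have hle : ordAt P w ≤ m := by
      have h1 := natDegree_le_of_dvd ((le_ordAt_iff hP hm hw.1 _).mp le_rfl) hw.1
      have h2 := natDegree_lt_of_mem_lowDegree hw.2 hw.1
      rw [natDegree_pow, ← hn] at h1
      have := Nat.le_mul_of_pos_right (ordAt P w) hn0
      omega
    rw [Finset.sum_boole, Nat.cast_id]
    have : (Finset.range m).filter (fun j => P ^ (j + 1) ∣ w) = Finset.range (ordAt P w) := by
      ext j
      rw [Finset.mem_filter, ← le_ordAt_iff hP hm hw.1, Finset.mem_range, Finset.mem_range]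
      omega
    rw [this, Finset.card_range]
  have hcount (j : ℕ) : ∑ w ∈ (lowDegree F m).erase 0, (if P ^ (j + 1) ∣ w then 1 else 0)
      ≤ if (j + 1) * n < m then q ^ (m - (j + 1) * n) else 0 := by
    rw [Finset.sum_boole, Nat.cast_id]
    have hPj : P ^ (j + 1) ≠ 0 := pow_ne_zero _ hP.ne_zero
    split_ifs with hj
    · have h0 : (0 : F[X]) ∈ lowDegree F m := by simp [bot_lt_iff_ne_bot]
      have := card_filter_dvd_sub_le hPj h0
      rw [natDegree_pow] at this
      refine le_trans (Finset.card_le_card fun w hw => ?_) this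
      rw [Finset.mem_filter, Finset.mem_erase] at hw
      rw [Finset.mem_filter, sub_zero]
      exact ⟨hw.1.2, hw.2⟩
    · rw [Nat.le_zero, Finset.card_eq_zero, Finset.filter_eq_empty_iff]
      intro w hw hdvd
      rw [Finset.mem_erase] at hw
      have h1 := natDegree_le_of_dvd hdvd hw.1
      have h2 := natDegree_lt_of_mem_lowDegree hw.2 hw.1
      rw [natDegree_pow, ← hn] at h1
      omega
  have htel (J : ℕ) : (∑ j ∈ Finset.range J,
      if (j + 1) * n < m then q ^ (m - (j + 1) * n) else 0) * (q ^ n - 1) + q ^ (m - J * n)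
        ≤ q ^ m := by
    induction J with
    | zero => simp
    | succ J ih =>
      refine le_trans ?_ ih
      rw [Finset.sum_range_succ, add_mul, add_assoc]
      refine Nat.add_le_add_left ?_ _
      split_ifs with hj
      · have h1 : m - J * n = (m - (J + 1) * n) + n := by
          rw [add_mul, one_mul] at hj ⊢
          omega
        rw [h1, pow_add, ← Nat.mul_add_one]
        refine (Nat.mul_le_mul_left _ ?_)
        have := Nat.one_le_pow n q (by omega)
        omega
      · rw [zero_mul, zero_add]
        refine Nat.pow_le_pow_right (by omega) ?_
        rw [add_mul, one_mul]
        omega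
  rw [Finset.sum_congr rfl hord, Finset.sum_comm]
  refine le_trans (Nat.mul_le_mul_right _ (Finset.sum_le_sum fun j _ => hcount j)) ?_
  exact (Nat.le_add_right _ _).trans (htel m)

end Counting


/-! ### Chebyshev's argument for smooth parts of values -/

section Chebyshev

open scoped Classical

variable {F : Type*} [Field F] [Finite F]

variable (F) in
/-- The monic irreducible polynomials of degree at most `y`. -/
noncomputable def primesUpTo (y : ℕ) : Finset F[X] :=
  (Finset.Icc 1 y).biUnion (primesOfDegree F)

lemma mem_primesUpTo {y : ℕ} {P : F[X]} :
    P ∈ primesUpTo F y ↔ Irreducible P ∧ P.Monic ∧ P.natDegree ≤ y := by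
  simp only [primesUpTo, Finset.mem_biUnion, Finset.mem_Icc, mem_primesOfDegree]
  constructor
  · rintro ⟨n, hn, h1, h2, rfl⟩
    exact ⟨h1, h2, hn.2⟩
  · rintro ⟨h1, h2, h3⟩
    exact ⟨_, ⟨h1.natDegree_pos, h3⟩, h1, h2, rfl⟩

lemma card_primesUpTo_le (y : ℕ) : (primesUpTo F y).card ≤ Nat.card F ^ (y + 1) := by
  rw [← card_lowDegree]
  refine Finset.card_le_card fun P hP => ?_
  rw [mem_primesUpTo] at hP
  rw [mem_lowDegree, degree_eq_natDegree hP.1.ne_zero, Nat.cast_lt]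
  omega

lemma sum_primesUpTo {M : Type*} [AddCommMonoid M] (y : ℕ) (f : F[X] → M) :
    ∑ P ∈ primesUpTo F y, f P = ∑ n ∈ Finset.Icc 1 y, ∑ P ∈ primesOfDegree F n, f P := by
  rw [primesUpTo, Finset.sum_biUnion]
  intro i _ j _ hij
  rw [Function.onFun, Finset.disjoint_left]
  intro P hP hP'
  rw [mem_primesOfDegree] at hP hP'
  exact hij (hP.2.2.symm.trans hP'.2.2)

/-- The average over `w` of the degree of the `y`-smooth part of `w` is at most `y + 2`. -/
lemma sum_smooth_lowDegree_le (m y : ℕ) :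
    ∑ P ∈ primesUpTo F y, P.natDegree * ∑ w ∈ (lowDegree F m).erase 0, ordAt P w
      ≤ Nat.card F ^ m * (y + 2) := by
  set q := Nat.card F with hq
  have hq1 : 2 ≤ q := Finite.one_lt_card
  -- There are at most q^n / n primes of degree n, each contributing at most n q^m / (q^n - 1), and
  -- q^n / (q^n - 1) ≤ 1 + 2 / 2^n since q ≥ 2.
  have hterm (n : ℕ) (hn : n ∈ Finset.Icc 1 y) :
      ((∑ P ∈ primesOfDegree F n, P.natDegree * ∑ w ∈ (lowDegree F m).erase 0, ordAt P w : ℕ) : ℝ)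
        ≤ (q : ℝ) ^ m * (1 + 2 * (1 / 2) ^ n) := by
    rw [Finset.mem_Icc] at hn
    have hpow : 2 ^ n ≤ q ^ n := Nat.pow_le_pow_left hq1 n
    have h2n : 2 ≤ 2 ^ n := by
      calc 2 = 2 ^ 1 := rfl
        _ ≤ 2 ^ n := Nat.pow_le_pow_right (by norm_num) hn.1
    have h1 : (∑ P ∈ primesOfDegree F n,
        P.natDegree * ∑ w ∈ (lowDegree F m).erase 0, ordAt P w) * (q ^ n - 1)
          ≤ q ^ n * q ^ m := by
      rw [Finset.sum_mul]
      calc _ ≤ ∑ P ∈ primesOfDegree F n, n * q ^ m := by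
            refine Finset.sum_le_sum fun P hP => ?_
            rw [mem_primesOfDegree] at hP
            have := sum_ordAt_lowDegree_le hP.1 hP.2.1 m
            rw [hP.2.2] at this ⊢
            rw [mul_assoc]
            exact Nat.mul_le_mul_left _ this
        _ = n * (primesOfDegree F n).card * q ^ m := by
            rw [Finset.sum_const, smul_eq_mul]; ring
        _ ≤ _ := Nat.mul_le_mul_right _ (mul_card_primesOfDegree_le (by omega))
    generalize (∑ P ∈ primesOfDegree F n,
        P.natDegree * ∑ w ∈ (lowDegree F m).erase 0, ordAt P w) = a at h1 ⊢
    have hr : (a : ℝ) * ((q : ℝ) ^ n - 1) ≤ (q : ℝ) ^ n * (q : ℝ) ^ m := by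
      have : ((q ^ n - 1 : ℕ) : ℝ) = (q : ℝ) ^ n - 1 := by
        rw [Nat.cast_sub (by omega)]; push_cast; rfl
      rw [← this]
      exact_mod_cast h1
    have hpowr : (2 : ℝ) ^ n ≤ (q : ℝ) ^ n := by exact_mod_cast hpow
    have h2nr : (2 : ℝ) ≤ 2 ^ n := by exact_mod_cast h2n
    have hpos : 0 < (q : ℝ) ^ n - 1 := by linarith
    refine le_of_mul_le_mul_right (hr.trans ?_) hpos
    rw [mul_comm ((q : ℝ) ^ n), mul_assoc]
    refine mul_le_mul_of_nonneg_left ?_ (by positivity)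
    have h3 : (1 / 2 : ℝ) ^ n * 2 ^ n = 1 := by rw [← mul_pow]; norm_num
    have h4 : 0 < (1 / 2 : ℝ) ^ n := by positivity
    nlinarith [mul_le_mul_of_nonneg_left hpowr h4.le, mul_le_mul_of_nonneg_left h2nr h4.le]
  have hgeo : ∑ n ∈ Finset.Icc 1 y, (2 : ℝ) * (1 / 2) ^ n ≤ 2 := by
    have h : ∀ y : ℕ, ∑ n ∈ Finset.Icc 1 y, (2 : ℝ) * (1 / 2) ^ n = 2 - 2 * (1 / 2) ^ y := by
      intro y
      induction y with
      | zero => simp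
      | succ y ih => rw [Finset.sum_Icc_succ_top (by omega), ih, pow_succ]; ring
    rw [h]
    have : 0 < (1 / 2 : ℝ) ^ y := by positivity
    linarith
  rw [sum_primesUpTo]
  have : ((∑ n ∈ Finset.Icc 1 y, ∑ P ∈ primesOfDegree F n,
      P.natDegree * ∑ w ∈ (lowDegree F m).erase 0, ordAt P w : ℕ) : ℝ)
      ≤ (q : ℝ) ^ m * (y + 2) := by
    rw [Nat.cast_sum]
    refine (Finset.sum_le_sum hterm).trans ?_
    rw [← Finset.mul_sum, Finset.sum_add_distrib]
    refine mul_le_mul_of_nonneg_left ?_ (by positivity)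
    simpa using hgeo
  exact_mod_cast this

/-- The exceptional points of `exists_ordAt_base` cost at most W each. Elsewhere the valuation is
bounded through the differences u - b, which for fixed b are distinct nonzero polynomials of degree
< m. -/
lemma natDegree_mul_sum_ordAt_eval_le {R : F[X][X]} (hR : R ≠ 0) {m W : ℕ} {V : Finset F[X]}
    (hV : V ⊆ lowDegree F m) (hV0 : ∀ u ∈ V, R.eval u ≠ 0)
    (hW : ∀ u ∈ V, (R.eval u).natDegree ≤ W) {P : F[X]} (hP : Irreducible P) (hm : P.Monic) :
    P.natDegree * ∑ u ∈ V, ordAt P (R.eval u) ≤ R.natDegree * W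
      + Nat.card F ^ m * (P.natDegree * ordAt P R.leadingCoeff)
      + R.natDegree * (P.natDegree * ∑ w ∈ (lowDegree F m).erase 0, ordAt P w) := by
  obtain ⟨B, hB, hBc, hBle⟩ := exists_ordAt_base hR hV0 hP hm
  rw [← Finset.sum_sdiff hB, mul_add, add_comm, add_assoc]
  refine add_le_add ?_ ?_
  · rw [Finset.mul_sum]
    refine (Finset.sum_le_card_nsmul _ _ W fun b hb => ?_).trans
      (Nat.mul_le_mul_right _ hBc)
    have h1 := sum_natDegree_mul_ordAt_le (hV0 b (hB hb)) {P}
    rw [Finset.sum_singleton] at h1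
    exact h1.trans (hW b (hB hb))
  · have h1 : ∑ u ∈ V \ B, ordAt P (R.eval u) ≤ Nat.card F ^ m * ordAt P R.leadingCoeff
        + R.natDegree * ∑ w ∈ (lowDegree F m).erase 0, ordAt P w := by
      calc _ ≤ ∑ u ∈ V \ B, (ordAt P R.leadingCoeff + ∑ b ∈ B, ordAt P (u - b)) :=
            Finset.sum_le_sum fun u hu =>
              hBle u (Finset.mem_sdiff.mp hu).1 (Finset.mem_sdiff.mp hu).2
        _ = (V \ B).card * ordAt P R.leadingCoeff
              + ∑ b ∈ B, ∑ u ∈ V \ B, ordAt P (u - b) := by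
            rw [Finset.sum_add_distrib, Finset.sum_const, smul_eq_mul, Finset.sum_comm]
        _ ≤ _ := by
            refine add_le_add (Nat.mul_le_mul_right _ ?_) ?_
            · rw [← card_lowDegree]
              exact Finset.card_le_card (Finset.sdiff_subset.trans hV)
            · refine (Finset.sum_le_card_nsmul _ _ _ fun b hb => ?_).trans
                (Nat.mul_le_mul_right _ hBc)
              rw [← Finset.sum_image (f := fun w => ordAt P w) (g := fun u => u - b)
                (fun x _ y _ h => sub_left_injective h)]
              refine Finset.sum_le_sum_of_subset fun w hw => ?_
              obtain ⟨u, hu, rfl⟩ := Finset.mem_image.mp hw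
              rw [Finset.mem_sdiff] at hu
              exact Finset.mem_erase.mpr ⟨fun h => hu.2 (sub_eq_zero.mp h ▸ hb),
                sub_mem_lowDegree (hV hu.1) (hV (hB hb))⟩
    refine (Nat.mul_le_mul_left _ h1).trans_eq ?_
    ring

lemma sum_smooth_eval_le {R : F[X][X]} (hR : R ≠ 0) {m W y : ℕ} {V : Finset F[X]}
    (hV : V ⊆ lowDegree F m) (hV0 : ∀ u ∈ V, R.eval u ≠ 0)
    (hW : ∀ u ∈ V, (R.eval u).natDegree ≤ W) :
    ∑ u ∈ V, ∑ P ∈ primesUpTo F y, P.natDegree * ordAt P (R.eval u)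
      ≤ Nat.card F ^ (y + 1) * (R.natDegree * W) + Nat.card F ^ m * R.leadingCoeff.natDegree
        + R.natDegree * (Nat.card F ^ m * (y + 2)) := by
  rw [Finset.sum_comm]
  calc _ ≤ ∑ P ∈ primesUpTo F y, (R.natDegree * W
      + Nat.card F ^ m * (P.natDegree * ordAt P R.leadingCoeff)
      + R.natDegree * (P.natDegree * ∑ w ∈ (lowDegree F m).erase 0, ordAt P w)) := by
        refine Finset.sum_le_sum fun P hP => ?_
        rw [mem_primesUpTo] at hP
        rw [← Finset.mul_sum]
        exact natDegree_mul_sum_ordAt_eval_le hR hV hV0 hW hP.1 hP.2.1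
    _ ≤ _ := by
        rw [Finset.sum_add_distrib, Finset.sum_add_distrib, Finset.sum_const, smul_eq_mul,
          ← Finset.mul_sum, ← Finset.mul_sum]
        refine add_le_add (add_le_add ?_ ?_) ?_
        · exact Nat.mul_le_mul_right _ (card_primesUpTo_le y)
        · exact Nat.mul_le_mul_left _
            (sum_natDegree_mul_ordAt_le (leadingCoeff_ne_zero.mpr hR) _)
        · exact Nat.mul_le_mul_left _ (sum_smooth_lowDegree_le m y)

/-- Many values of `R` have an irreducible factor of degree larger than `y`. -/
lemma le_card_rough_eval {R : F[X][X]} (hR : R ≠ 0) {m W y t : ℕ} {V : Finset F[X]}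
    (hV : V ⊆ lowDegree F m) (hV0 : ∀ u ∈ V, R.eval u ≠ 0)
    (hW : ∀ u ∈ V, (R.eval u).natDegree ≤ W) :
    V.card * (R.leadingCoeff.natDegree + R.natDegree * t)
      ≤ Nat.card F ^ (y + 1) * (R.natDegree * W) + Nat.card F ^ m * R.leadingCoeff.natDegree
        + R.natDegree * (Nat.card F ^ m * (y + 2))
        + ((V.filter fun u => ∃ P, Irreducible P ∧ P.Monic ∧ P ∣ R.eval u ∧ y < P.natDegree).card
          + R.natDegree * Nat.card F ^ t) * (R.leadingCoeff.natDegree + R.natDegree * t) := by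
  set D := R.leadingCoeff.natDegree + R.natDegree * t with hD
  set G := V.filter fun u => ∃ P, Irreducible P ∧ P.Monic ∧ P ∣ R.eval u ∧ y < P.natDegree with hG
  set L := V.filter fun u => (R.eval u).natDegree < D with hL
  have hcard : V.card ≤ (V \ (G ∪ L)).card + (G.card + R.natDegree * Nat.card F ^ t) := by
    have h1 := Finset.le_card_sdiff (G ∪ L) V
    have h2 := Finset.card_union_le G L
    have h3 : L.card ≤ _ := card_low_eval_le hR V t
    omega
  -- Outside G and L the value R(u) is y-smooth, so its smooth part has the full degree, at least D.
  have hmain : (V \ (G ∪ L)).card * D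
      ≤ ∑ u ∈ V, ∑ P ∈ primesUpTo F y, P.natDegree * ordAt P (R.eval u) := by
    refine le_trans ?_ (Finset.sum_le_sum_of_subset (Finset.sdiff_subset (t := G ∪ L)))
    refine Finset.card_nsmul_le_sum _ _ _ fun u hu => ?_
    rw [Finset.mem_sdiff, Finset.mem_union, not_or] at hu
    obtain ⟨huV, huG, huL⟩ := hu
    rw [sum_natDegree_mul_ordAt_eq (hV0 u huV)]
    · by_contra! hlt
      exact huL (Finset.mem_filter.mpr ⟨huV, hlt⟩)
    · intro P hP hm hdvd
      refine mem_primesUpTo.mpr ⟨hP, hm, ?_⟩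
      by_contra! hlt
      exact huG (Finset.mem_filter.mpr ⟨huV, P, hP, hm, hdvd, hlt⟩)
  calc V.card * D ≤ (V \ (G ∪ L)).card * D + (G.card + R.natDegree * Nat.card F ^ t) * D := by
        rw [← add_mul]; exact Nat.mul_le_mul_right _ hcard
    _ ≤ _ := Nat.add_le_add_right (hmain.trans (sum_smooth_eval_le hR hV hV0 hW)) _

end Chebyshev

/-! ### Selecting points with private primes -/

section PrivatePrimes

open scoped Classical

variable {F : Type*} [Field F]

lemma card_bigPrimes_le {f : F[X]} (hf : f ≠ 0) {y W c : ℕ} (hW : f.natDegree ≤ W)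
    (hc : W < (c + 1) * (y + 1)) :
    ((normalizedFactors f).toFinset.filter fun P => y < P.natDegree).card ≤ c := by
  set s := (normalizedFactors f).toFinset.filter fun P => y < P.natDegree with hs
  have h1 : s.card * (y + 1) ≤ f.natDegree := by
    refine le_trans ?_ (sum_natDegree_mul_ordAt_le hf s)
    refine Finset.card_nsmul_le_sum s (fun P => P.natDegree * ordAt P f) (y + 1) fun P hP => ?_
    rw [hs, Finset.mem_filter, Multiset.mem_toFinset] at hP
    have h2 : 1 ≤ ordAt P f := Multiset.one_le_count_iff_mem.mpr hP.1
    have := Nat.mul_le_mul_left P.natDegree h2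
    omega
  by_contra! hlt
  have := Nat.mul_le_mul_right (y + 1) (Nat.succ_le_of_lt hlt)
  rw [Nat.succ_eq_add_one] at this
  omega

variable [Finite F]

/-- Choose a large prime p(u) of R(u) for each u and take a maximal A without conflicts. If w
conflicts with u in A, then w ≡ u modulo p(u) or p(w); in the latter case p(w) divides R(u) as well.
Either way the modulus is one of the at most c large primes of R(u), so u blocks few w. -/
lemma exists_private_primes {R : F[X][X]} {m W y c : ℕ} {G : Finset F[X]}
    (hG : G ⊆ lowDegree F m) (hG0 : ∀ u ∈ G, R.eval u ≠ 0)
    (hW : ∀ u ∈ G, (R.eval u).natDegree ≤ W) (hc : W < (c + 1) * (y + 1))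
    (hp : ∀ u ∈ G, ∃ P, Irreducible P ∧ P.Monic ∧ P ∣ R.eval u ∧ y < P.natDegree) :
    ∃ A ⊆ G, G.card ≤ A.card * (c * Nat.card F ^ (m - (y + 1))) ∧
      ∀ u ∈ A, ∃ P, Irreducible P ∧ P ∣ R.eval u ∧ ∀ w ∈ A, w ≠ u → ¬ P ∣ w - u := by
  choose! p hp1 hp2 hp3 hp4 using hp
  obtain ⟨A, hA, hpair, hmax⟩ := exists_maximal_pairwise G
    (fun u w => ¬ p u ∣ w - u ∧ ¬ p w ∣ u - w) (fun u w h => ⟨h.2, h.1⟩)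
  refine ⟨A, hA, ?_, fun u hu => ⟨p u, hp1 u (hA hu), hp3 u (hA hu), fun w hw hne =>
    (hpair hu hw hne.symm).1⟩⟩
  have hbig (u w : F[X]) (hu : u ∈ G) (hw : w ∈ G) (h : p w ∣ u - w) :
      p w ∈ (normalizedFactors (R.eval u)).toFinset.filter fun P => y < P.natDegree := by
    have h1 : p w ∣ R.eval u := by
      have := (h.trans (sub_dvd_eval_sub u w R))
      exact (dvd_sub_left (hp3 w hw)).mp this
    rw [Finset.mem_filter, Multiset.mem_toFinset, mem_normalizedFactors_iff' (hG0 u hu)]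
    exact ⟨⟨hp1 w hw, (hp2 w hw).normalize_eq_self, h1⟩, hp4 w hw⟩
  have hsub : G ⊆ A.biUnion fun u =>
      ((normalizedFactors (R.eval u)).toFinset.filter fun P => y < P.natDegree).biUnion fun P =>
        (lowDegree F m).filter fun w => P ∣ w - u := by
    intro w hw
    have key : ∃ u ∈ A, ∃ P ∈ (normalizedFactors (R.eval u)).toFinset.filter
        (fun P => y < P.natDegree), P ∣ w - u := by
      by_cases hwA : w ∈ A
      · exact ⟨w, hwA, p w, hbig w w hw hw (by simp), by simp⟩
      · obtain ⟨u, hu, h⟩ := hmax w hw hwA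
        rw [not_and_or, not_not, not_not] at h
        rcases h with h | h
        · exact ⟨u, hu, p w, hbig u w (hA hu) hw h, (dvd_sub_comm).mp h⟩
        · exact ⟨u, hu, p u, hbig u u (hA hu) (hA hu) (by simp), h⟩
    obtain ⟨u, hu, P, hP, h⟩ := key
    exact Finset.mem_biUnion.mpr ⟨u, hu, Finset.mem_biUnion.mpr ⟨P, hP,
      Finset.mem_filter.mpr ⟨hG hw, h⟩⟩⟩
  refine (Finset.card_le_card hsub).trans (Finset.card_biUnion_le_card_mul _ _ _ fun u hu => ?_)
  refine (Finset.card_biUnion_le_card_mul _ _ (Nat.card F ^ (m - (y + 1))) fun P hP => ?_).trans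
    (Nat.mul_le_mul_right _ (card_bigPrimes_le (hG0 u (hA hu)) (hW u (hA hu)) hc))
  rw [Finset.mem_filter, Multiset.mem_toFinset] at hP
  refine (card_filter_dvd_sub_le (irreducible_of_normalized_factor P hP.1).ne_zero
    (hG (hA hu))).trans ?_
  exact Nat.pow_le_pow_right Nat.card_pos (by omega)

/-- The values of `R` on a set of almost full density have private irreducible factors on a
subset of size `q ^ (m - o(m))`. -/
theorem exists_large_private_primes {R : F[X][X]} (hR : R.natDegree ≠ 0) {m N s : ℕ}
    (hN : R.natDegree ≤ N) (hs : 1 ≤ s) (hsm : 4 * s + 2 ≤ m)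
    (hsN : 32 * N ^ 2 * m ≤ Nat.card F ^ s) {V : Finset F[X]}
    (hV : V ⊆ lowDegree F m) (hVc : Nat.card F ^ m ≤ V.card + 1)
    (hV0 : ∀ u ∈ V, R.eval u ≠ 0) (hW : ∀ u ∈ V, (R.eval u).natDegree ≤ N * m)
    (hlc : R.leadingCoeff.natDegree ≤ N * m) :
    ∃ A ⊆ V, Nat.card F ^ m ≤ A.card * Nat.card F ^ (3 * s + 1) ∧
      ∀ u ∈ A, ∃ P, Irreducible P ∧ P ∣ R.eval u ∧ ∀ w ∈ A, w ≠ u → ¬ P ∣ w - u := by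
  have hR0 : R ≠ 0 := fun h => hR (by simp [h])
  -- With t = m - s below, t - (y + 2) = s ≥ 1 is the surplus of generic over smooth degree. Also y
  -- + 1 ≥ m / 2, so a value of degree at most N m has at most 2N prime factors of degree > y.
  obtain ⟨y, hy⟩ : ∃ y, m = y + (2 * s + 2) := ⟨m - (2 * s + 2), by omega⟩
  obtain ⟨t, ht⟩ : ∃ t, m = t + s := ⟨m - s, by omega⟩
  set G := V.filter fun u => ∃ P, Irreducible P ∧ P.Monic ∧ P ∣ R.eval u ∧ y < P.natDegree with hG
  have hcount := le_card_rough_eval hR0 (y := y) (t := t) hV hV0 hW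
  rw [← hG] at hcount
  obtain ⟨A, hA, hAc, hAp⟩ := exists_private_primes (R := R) (G := G) (m := m) (W := N * m)
    (y := y) (c := 2 * N) ((Finset.filter_subset _ _).trans hV)
    (fun u hu => hV0 u (Finset.mem_filter.mp hu).1)
    (fun u hu => hW u (Finset.mem_filter.mp hu).1)
    (by nlinarith) (fun u hu => (Finset.mem_filter.mp hu).2)
  refine ⟨A, hA.trans (Finset.filter_subset _ _), ?_, hAp⟩
  have hexp : m - (y + 1) = 2 * s + 1 := by omega
  rw [hexp] at hAc
  have hq : 1 ≤ Nat.card F := Nat.card_pos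
  set q := Nat.card F with hq_def
  generalize R.leadingCoeff.natDegree = l at *
  generalize R.natDegree = d at *
  generalize G.card = g at *
  generalize V.card = v at *
  have hgood : q ^ m ≤ 4 * N * m * g := by
    have hd : 1 ≤ d := Nat.one_le_iff_ne_zero.mpr hR
    have hNN : 1 ≤ N := hd.trans hN
    have hty : t = y + 2 + s := by omega
    have hTQ : q ^ m = q ^ t * q ^ s := by rw [ht, pow_add]
    have hYT : q ^ (y + 1) ≤ q ^ t := Nat.pow_le_pow_right hq (by omega)
    have hT1 : 1 ≤ q ^ t := Nat.one_le_pow _ _ hq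
    have hD : l + d * t ≤ 2 * N * m := by
      have : d * t ≤ N * m := Nat.mul_le_mul hN (by omega)
      nlinarith
    have h1 : q ^ m * (l + d * t) ≤ (v + 1) * (l + d * t) := Nat.mul_le_mul_right _ hVc
    generalize q ^ m = Q at *
    generalize q ^ t = T at *
    generalize q ^ (y + 1) = Y at *
    -- The contributions Q l of the leading coefficient cancel and only the surplus s = t - (y + 2)
    -- remains.
    have h2 : Q * d * s ≤ (1 + g + d * T) * (l + d * t) + Y * (d * (N * m)) := by
      have h3 : Q * (d * t) = Q * d * s + d * (Q * (y + 2)) := by rw [hty]; ring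
      nlinarith
    have h4 : (1 + g + d * T) * (l + d * t) ≤ (1 + g + d * T) * (2 * N * m) :=
      Nat.mul_le_mul_left _ hD
    have h5 : Y * (d * (N * m)) ≤ T * (d * (N * m)) := Nat.mul_le_mul_right _ hYT
    have h6 : 1 * (2 * N * m) ≤ d * T * (2 * N * m) :=
      Nat.mul_le_mul_right _ (Nat.mul_le_mul hd hT1)
    have h7 : Q * d * 1 ≤ Q * d * s := Nat.mul_le_mul_left _ hs
    have h8 : Q * d ≤ g * (2 * N * m) + 5 * (d * (T * (N * m))) := by linarith
    have h9 : 32 * (T * (N * m)) ≤ Q := by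
      rw [hTQ]
      calc 32 * (T * (N * m)) = T * (32 * N * m) := by ring
        _ ≤ T * (32 * N ^ 2 * m) := by
          refine Nat.mul_le_mul_left _ (Nat.mul_le_mul_right _ (Nat.mul_le_mul_left _ ?_))
          exact Nat.le_self_pow (by norm_num) N
        _ ≤ T * q ^ s := Nat.mul_le_mul_left _ hsN
    have h10 : d * (32 * (T * (N * m))) ≤ d * Q := Nat.mul_le_mul_left _ h9
    have h11 : 1 * Q ≤ d * Q := Nat.mul_le_mul_right _ hd
    linarith
  calc q ^ m ≤ 4 * N * m * (A.card * (2 * N * q ^ (2 * s + 1))) :=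
        hgood.trans (Nat.mul_le_mul_left _ hAc)
    _ = A.card * (8 * N ^ 2 * m * q ^ (2 * s + 1)) := by ring
    _ ≤ A.card * (q ^ s * q ^ (2 * s + 1)) := by
        refine Nat.mul_le_mul_left _ (Nat.mul_le_mul_right _ (le_trans ?_ hsN))
        exact Nat.mul_le_mul_right _ (Nat.mul_le_mul_right _ (by norm_num))
    _ = A.card * q ^ (3 * s + 1) := by rw [← pow_add]; congr 2; ring

end PrivatePrimes


/-! ### Large sets with distinct reciprocal sums -/

section Main

variable {F K : Type*} [Field F] [Field K] [Algebra F K]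

lemma aeval_ne_zero_of_natDegree_lt_finrank [FiniteDimensional F K] {α : K}
    (hα : IntermediateField.adjoin F {α} = ⊤) {r : F[X]} (hr : r ≠ 0)
    (hd : r.natDegree < Module.finrank F K) : aeval α r ≠ 0 := by
  intro h
  have hint : IsIntegral F α := Algebra.IsIntegral.isIntegral α
  have h1 := IntermediateField.adjoin.finrank hint
  rw [hα, IntermediateField.finrank_top'] at h1
  have h2 := natDegree_le_of_dvd (minpoly.dvd F α h) hr
  omega

/-- A root -u would make R equal to Y + u up to a unit, and R vanishes at (α, γ). -/
lemma eval_neg_ne_zero_of_irreducible {α γ : K} {R : F[X][X]} (hR : Irreducible R)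
    (hRe : evalAt F α γ R = 0) {u : F[X]} (hu : γ + aeval α u ≠ 0) : R.eval (-u) ≠ 0 := by
  intro h
  have h1 : X - C (-u) ∣ R := dvd_iff_isRoot.mpr h
  obtain ⟨c, hc⟩ := h1
  have hcu : IsUnit c := (hR.isUnit_or_isUnit hc).resolve_left (not_isUnit_X_sub_C _)
  rw [hc, map_mul, mul_eq_zero] at hRe
  rcases hRe with h2 | h2
  · rw [map_sub, evalAt_X, evalAt_C, map_neg, sub_neg_eq_add] at h2
    exact hu h2
  · exact (hcu.map (evalAt F α γ)).ne_zero h2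

variable [Finite F]

lemma pow_le_card_filter_add_one {α γ : K} {m : ℕ}
    (hα : ∀ r : F[X], r ≠ 0 → r.natDegree < m → aeval α r ≠ 0) [DecidableEq K] :
    Nat.card F ^ m ≤ ((lowDegree F m).filter fun u => γ + aeval α u ≠ 0).card + 1 := by
  rw [← card_lowDegree, ← Finset.card_filter_add_card_filter_not (fun u => γ + aeval α u ≠ 0)]
  refine Nat.add_le_add_left ?_ _
  rw [Finset.card_le_one]
  intro u hu w hw
  rw [Finset.mem_filter, not_not] at hu hw
  by_contra hne
  have h0 := sub_ne_zero.mpr hne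
  refine hα _ h0 (natDegree_lt_of_mem_lowDegree (sub_mem_lowDegree hu.1 hw.1) h0) ?_
  rw [map_sub, sub_eq_zero]
  exact add_left_cancel (hu.2.trans hw.2.symm)

/-- There is a set of almost full size all of whose `k`-element subsets have distinct sums of
reciprocals. -/
theorem exists_large_set_injOn_sum_inv {α γ : K} {n m k s : ℕ} (hk : 1 ≤ k)
    (hα : ∀ r : F[X], r ≠ 0 → r.natDegree < n → aeval α r ≠ 0)
    (hn : (2 * k - 1) * (2 * k - 1) * (m - 1) < n) (hs : 1 ≤ s) (hsm : 4 * s + 2 ≤ m)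
    (hsN : 32 * (2 * k - 1) ^ 2 * m ≤ Nat.card F ^ s) :
    ∃ A ⊆ lowDegree F m, (∀ u ∈ A, γ + aeval α u ≠ 0) ∧
      Nat.card F ^ m ≤ A.card * Nat.card F ^ (3 * s + 1) ∧
      Set.InjOn (fun S : Finset F[X] => ∑ u ∈ S, (γ + aeval α u)⁻¹)
        (A.powersetCard k : Set (Finset F[X])) := by
  classical
  have hq : 2 ≤ Nat.card F := Finite.one_lt_card
  obtain ⟨N, hN⟩ : ∃ N, N = 2 * k - 1 := ⟨_, rfl⟩
  obtain ⟨μ, rfl⟩ : ∃ μ, m = μ + 1 := ⟨m - 1, by omega⟩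
  rw [Nat.add_sub_cancel] at hn
  rw [← hN] at hn hsN
  have hN1 : 1 ≤ N := by omega
  have hμn : μ + 1 ≤ n := by
    have : 1 * μ ≤ N * N * μ := Nat.mul_le_mul_right _ (Nat.mul_le_mul hN1 hN1)
    omega
  have hdeg : ∀ u ∈ lowDegree F (μ + 1), u.natDegree ≤ μ := by
    intro u hu
    by_cases h0 : u = 0
    · simp [h0]
    · exact Nat.le_of_lt_succ (natDegree_lt_of_mem_lowDegree hu h0)
  set V := (lowDegree F (μ + 1)).filter fun u => γ + aeval α u ≠ 0 with hV
  have hVsub : V ⊆ lowDegree F (μ + 1) := Finset.filter_subset _ _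
  have hV0 : ∀ u ∈ V, γ + aeval α u ≠ 0 := fun u hu => (Finset.mem_filter.mp hu).2
  have hVc : Nat.card F ^ (μ + 1) ≤ V.card + 1 :=
    pow_le_card_filter_add_one fun r hr hd => hα r hr (by omega)
  -- Without collisions all of V serves; otherwise a single collision supplies the R that governs
  -- every other one.
  by_cases hinj : Set.InjOn (fun S : Finset F[X] => ∑ u ∈ S, (γ + aeval α u)⁻¹)
        (V.powersetCard k : Set (Finset F[X]))
  · refine ⟨V, hVsub, hV0, ?_, hinj⟩
    have h1 : 2 ^ 1 ≤ Nat.card F ^ (3 * s + 1) :=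
      (Nat.pow_le_pow_right (by norm_num) (by omega)).trans (Nat.pow_le_pow_left hq _)
    have h2 : 2 ^ 1 ≤ Nat.card F ^ (μ + 1) :=
      (Nat.pow_le_pow_right (by norm_num) (by omega)).trans (Nat.pow_le_pow_left hq _)
    have h3 := Nat.mul_le_mul_left V.card h1
    omega
  · simp only [Set.InjOn, not_forall] at hinj
    obtain ⟨S, hS, T, hT, hST, hne⟩ := hinj
    obtain ⟨Q, hQe, hQw, u, -, U, -, huU, hQ⟩ := exists_poly_of_collision
      (fun u hu => hdeg u (hVsub hu)) hV0 hS hT hne hST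
    rw [← hN] at hQw
    obtain ⟨R, hR, hR0, hRw, hRe, hRdvd⟩ := exists_irreducible_relation (by omega) hα hn
      (poly_of_collision_ne_zero huU hQ) hQw hQe
    have hcomp (u : F[X]) : (R.comp (-X)).eval u = R.eval (-u) := by simp
    have hRd : (R.comp (-X)).natDegree = R.natDegree := by
      rw [natDegree_comp, natDegree_neg, natDegree_X, mul_one]
    have hNm : N * μ ≤ N * (μ + 1) := Nat.mul_le_mul_left _ (by omega)
    obtain ⟨A, hA, hAc, hAp⟩ := exists_large_private_primes (R := R.comp (-X)) (by rwa [hRd])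
      (N := N) (by rw [hRd]; exact natDegree_le_of_weight (by omega) hRw) hs hsm hsN hVsub hVc
      (fun u hu => by rw [hcomp]; exact eval_neg_ne_zero_of_irreducible hR hRe (hV0 u hu))
      (fun u hu => by
        rw [hcomp]
        refine (natDegree_eval_le_of_weight hRw ?_).trans hNm
        rw [natDegree_neg]
        exact hdeg u (hVsub hu))
      (by
        rw [leadingCoeff_comp (by simp), leadingCoeff_neg, leadingCoeff_X]
        have h1 := (natDegree_weightHom_le_iff _ _ _).mp hRw R.natDegree
          (by simpa using leadingCoeff_ne_zero.mpr hR.ne_zero)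
        rw [coeff_natDegree] at h1
        have h2 : (((-1 : F[X])) ^ R.natDegree).natDegree = 0 := by
          rcases neg_one_pow_eq_or F[X] R.natDegree with h | h <;> simp [h]
        have h3 := natDegree_mul_le (p := R.leadingCoeff) (q := (-1 : F[X]) ^ R.natDegree)
        omega)
    refine ⟨A, hA.trans hVsub, fun u hu => hV0 u (hA hu), hAc, ?_⟩
    refine injOn_sum_inv_of_private_prime (μ := μ) (R := R)
      (fun u hu => hdeg u (hVsub (hA hu))) (fun u hu => hV0 u (hA hu))
      (by rwa [← hN]) fun u hu => ?_
    obtain ⟨P, hP, hPR, hPA⟩ := hAp u hu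
    exact ⟨P, hP, by rwa [hcomp] at hPR, hPA⟩

lemma sum_inv_mem_reciprocalSumset {α γ : K} {m k : ℕ} (hm : 0 < m) {A S : Finset F[X]}
    (hA : A ⊆ lowDegree F m) (hA0 : ∀ u ∈ A, γ + aeval α u ≠ 0) (hS : S ∈ A.powersetCard k) :
    ∑ u ∈ S, (γ + aeval α u)⁻¹ ∈ reciprocalSumset F α γ m k := by
  rw [Finset.mem_powersetCard] at hS
  let e := S.equivFinOfCardEq hS.2
  refine ⟨fun i => γ + aeval α (e.symm i : F[X]), fun i => ⟨⟨aeval α (e.symm i : F[X]), ?_, rfl⟩,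
    hA0 _ (hS.1 (e.symm i).2)⟩, ?_⟩
  · refine ⟨fun j => (e.symm i : F[X]).coeff j, ?_⟩
    have hd : (e.symm i : F[X]).natDegree < m := by
      by_cases h0 : (e.symm i : F[X]) = 0
      · simpa [h0] using hm
      · exact natDegree_lt_of_mem_lowDegree (hA (hS.1 (e.symm i).2)) h0
    rw [aeval_eq_sum_range' hd,
      Fin.sum_univ_eq_sum_range (fun j => (e.symm i : F[X]).coeff j • α ^ j) m]
  · rw [Equiv.sum_comp e.symm (fun u : S => (γ + aeval α (u : F[X]))⁻¹),
      Finset.sum_coe_sort S (fun u => (γ + aeval α u)⁻¹)]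

lemma choose_le_ncard_reciprocalSumset [FiniteDimensional F K] {α γ : K} {m k : ℕ} (hm : 0 < m)
    {A : Finset F[X]} (hA : A ⊆ lowDegree F m) (hA0 : ∀ u ∈ A, γ + aeval α u ≠ 0)
    (hinj : Set.InjOn (fun S : Finset F[X] => ∑ u ∈ S, (γ + aeval α u)⁻¹)
        (A.powersetCard k : Set (Finset F[X]))) :
    A.card.choose k ≤ (reciprocalSumset F α γ m k).ncard := by
  have : Finite K := Module.finite_of_finite F
  rw [← Finset.card_powersetCard, ← Set.ncard_coe_finset]
  exact Set.ncard_le_ncard_of_injOn _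
    (fun S hS => sum_inv_mem_reciprocalSumset hm hA hA0 hS) hinj (Set.toFinite _)

end Main

/-! ### Numerical estimates -/

section Numerics

/-- Uses binom(a, k) ≥ (a + 1 - k)^k / k!, with a + 1 - k ≥ kB and k! ≤ k^k. -/
lemma pow_le_choose_of_two_mul_le {a k B : ℕ} (hB : 1 ≤ B) (h : 2 * k * B ≤ a) :
    B ^ k ≤ a.choose k := by
  rcases Nat.eq_zero_or_pos k with rfl | hk
  · simp
  have h1 : k * B ≤ a + 1 - k := by
    have : k * 1 ≤ k * B := Nat.mul_le_mul_left _ hB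
    have : 2 * k * B = k * B + k * B := by ring
    omega
  have h2 : (a + 1 - k) ^ k ≤ k.factorial * a.choose k := by
    have := Nat.pow_le_choose (α := ℚ) k a
    rw [div_le_iff₀ (by positivity)] at this
    rw [mul_comm]
    exact_mod_cast this
  have h3 : k ^ k * B ^ k ≤ k ^ k * a.choose k := by
    rw [← mul_pow]
    exact (Nat.pow_le_pow_left h1 k).trans
      (h2.trans (Nat.mul_le_mul_right _ (Nat.factorial_le_pow k)))
  exact Nat.le_of_mul_le_mul_left h3 (Nat.pow_pos hk)

/-- Take s = ⌊√m⌋: 2^s outgrows any multiple of m while s = o(m). Base 2 makes the threshold uniform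
in q. -/
lemma exists_slack (k N : ℕ) (ε : ℝ) (hε : 0 < ε) :
    ∃ M : ℕ, ∀ m, M ≤ m → ∃ s : ℕ, 1 ≤ s ∧ 4 * s + 2 ≤ m ∧ 32 * N ^ 2 * m ≤ 2 ^ s ∧
      (k : ℝ) * (4 * s + 1) ≤ ε * m := by
  have hlim := tendsto_pow_const_div_const_pow_of_one_lt 2 (show (1 : ℝ) < 2 by norm_num)
  have hev := hlim.eventually_lt_const (show (0 : ℝ) < 1 / (64 * N ^ 2 + 1) by positivity)
  obtain ⟨s₀, hs₀⟩ := Filter.eventually_atTop.mp hev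
  obtain ⟨s₁, hs₁⟩ := exists_nat_ge (5 * k / ε)
  refine ⟨(s₀ + s₁ + 6) ^ 2, fun m hm => ⟨Nat.sqrt m, ?_⟩⟩
  have hs : s₀ + s₁ + 6 ≤ Nat.sqrt m := Nat.le_sqrt'.mpr hm
  have hlow : Nat.sqrt m ^ 2 ≤ m := Nat.sqrt_le' m
  have hup : m ≤ (Nat.sqrt m + 1) ^ 2 := (Nat.lt_succ_sqrt' m).le
  generalize Nat.sqrt m = s at *
  refine ⟨by omega, by nlinarith, ?_, ?_⟩
  · have h1 := hs₀ (s + 1) (by omega)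
    rw [div_lt_div_iff₀ (by positivity) (by positivity), one_mul, pow_succ] at h1
    have h2 : (s + 1) ^ 2 * (64 * N ^ 2 + 1) < 2 ^ s * 2 := by exact_mod_cast h1
    have h3 : 32 * N ^ 2 * m ≤ 32 * N ^ 2 * (s + 1) ^ 2 := Nat.mul_le_mul_left _ hup
    nlinarith
  · have h1 : 5 * (k : ℝ) ≤ ε * s := by
      rw [div_le_iff₀ hε] at hs₁
      have : (s₁ : ℝ) ≤ s := by exact_mod_cast (by omega : s₁ ≤ s)
      nlinarith
    have h2 : (1 : ℝ) ≤ s := by exact_mod_cast (by omega : 1 ≤ s)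
    have h3 : (s : ℝ) ^ 2 ≤ m := by exact_mod_cast hlow
    have hk : (0 : ℝ) ≤ k := Nat.cast_nonneg k
    nlinarith [mul_le_mul_of_nonneg_right h1 (by linarith : (0 : ℝ) ≤ s),
      mul_le_mul_of_nonneg_left h3 hε.le, mul_le_mul_of_nonneg_left h2 hk]

end Numerics

end ReciprocalSumset

/-! ### The final count -/

open ReciprocalSumset in
theorem corollary1p2 (k : ℕ) (hk : 1 ≤ k) (ε : ℝ) (hε : 0 < ε) :
    ∃ M : ℕ, ∀ (F : Type*) [Field F] [Finite F]
      (K : Type*) [Field K] [Algebra F K] [FiniteDimensional F K]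
      (q n m : ℕ) (α γ : K),
      Nat.card F = q → Module.finrank F K = n → IntermediateField.adjoin F {α} = ⊤ →
      M ≤ m → (m : ℝ) < (n : ℝ) / (4 * (k : ℝ) ^ 2 - 2 * (k : ℝ)) →
      (q : ℝ) ^ (((k : ℝ) - ε) * (m : ℝ)) ≤ ((reciprocalSumset F α γ m k).ncard : ℝ) := by
  obtain ⟨M, hM⟩ := exists_slack k (2 * k - 1) ε hε
  refine ⟨M, fun F _ _ K _ _ _ q n m α γ hq hn hα hm hmn => ?_⟩
  obtain ⟨s, hs1, hsm, hsN, hsε⟩ := hM m hm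
  have hq2 : 2 ≤ q := hq ▸ Finite.one_lt_card
  have hqs : 2 ^ s ≤ q ^ s := Nat.pow_le_pow_left hq2 s
  have hkr : (1 : ℝ) ≤ k := by exact_mod_cast hk
  -- Since k ≥ 1, (2k-1)² ≤ 4k² - 2k.
  have hn' : (2 * k - 1) * (2 * k - 1) * (m - 1) < n := by
    rw [lt_div_iff₀ (by nlinarith)] at hmn
    have h1 : (((2 * k - 1) * (2 * k - 1) * (m - 1) : ℕ) : ℝ)
        = (2 * k - 1) * (2 * k - 1) * (m - 1) := by
      push_cast [Nat.cast_sub (show 1 ≤ m by omega), Nat.cast_sub (show 1 ≤ 2 * k by omega)]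
      ring
    have h2 : (1 : ℝ) ≤ m := by exact_mod_cast (by omega : 1 ≤ m)
    have h3 : (((2 * k - 1) * (2 * k - 1) * (m - 1) : ℕ) : ℝ) < n := by
      rw [h1]
      refine lt_of_le_of_lt ?_ hmn
      nlinarith [mul_nonneg (sub_nonneg.mpr hkr) (sub_nonneg.mpr h2),
        mul_nonneg (mul_nonneg (sub_nonneg.mpr hkr) (sub_nonneg.mpr hkr)) (sub_nonneg.mpr h2)]
    exact_mod_cast h3
  obtain ⟨A, hA, hA0, hAc, hinj⟩ := exists_large_set_injOn_sum_inv (γ := γ) hk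
    (fun r hr hd => aeval_ne_zero_of_natDegree_lt_finrank hα hr (by rwa [hn])) hn' hs1 hsm
    (by rw [hq]; exact hsN.trans hqs)
  have hcount := choose_le_ncard_reciprocalSumset (by omega) hA hA0 hinj
  rw [hq] at hAc
  obtain ⟨c, hc⟩ : ∃ c, m = c + (4 * s + 1) := ⟨m - (4 * s + 1), by omega⟩
  -- A has at least q^s q^c elements, and q^s ≥ 32(2k-1)²m absorbs the factor 2k.
  have hB : 2 * k * q ^ c ≤ A.card := by
    have h1 : q ^ m = q ^ s * q ^ c * q ^ (3 * s + 1) := by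
      rw [hc, ← pow_add, ← pow_add]; congr 1; ring
    have h2 : q ^ s * q ^ c ≤ A.card :=
      Nat.le_of_mul_le_mul_right (h1 ▸ hAc) (Nat.pow_pos (by omega))
    refine (Nat.mul_le_mul_right _ ?_).trans h2
    refine le_trans ?_ (hsN.trans hqs)
    obtain ⟨j, rfl⟩ : ∃ j, k = j + 1 := ⟨k - 1, by omega⟩
    have h3 : 2 * (j + 1) - 1 = 2 * j + 1 := by omega
    rw [h3]
    have h4 : 1 ≤ m := by omega
    nlinarith
  have hfin := (pow_le_choose_of_two_mul_le (Nat.one_le_pow _ _ (by omega)) hB).trans hcount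
  have hq1 : (1 : ℝ) ≤ q := by exact_mod_cast (by omega : 1 ≤ q)
  calc (q : ℝ) ^ (((k : ℝ) - ε) * (m : ℝ)) ≤ (q : ℝ) ^ ((c * k : ℕ) : ℝ) := by
        refine Real.rpow_le_rpow_of_exponent_le hq1 ?_
        have : (m : ℝ) = c + (4 * s + 1) := by exact_mod_cast hc
        push_cast
        nlinarith
    _ = (((q ^ c) ^ k : ℕ) : ℝ) := by
        rw [Real.rpow_natCast]; push_cast; rw [pow_mul]
    _ ≤ _ := by exact_mod_cast hfin
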